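/- An *orbifold* $\mathcal O$ on $\mathbb{CP}^1$ is a function $\nu:\mathbb{CP}^1\to\mathbb N=\{1,2,\dots\}$ with $\nu(z)=1$ outside a finite set, which is *good*: $\nu$ is not different from $1$ at exactly one point, and if $\nu$ is different from $1$ at exactly two points $z_1,z_2$, then $\nu(z_1)=\nu(z_2)$. For orbifolds $\mathcal O_1,\mathcal O_2$ with ramification functions $\nu_1,\nu_2$, write $\mathcal O_1\preceq\mathcal O_2$ if $\nu_1(z)\mid\nu_2(z)$ for all $z\in\mathbb{CP}^1$. A nonconstant rational function $f$ is a *minimal holomorphic map* $f:\mathcal O_1\to\mathcal O_2$ if $$\nu_2(f(z))=\nu_1(z)\,\gcd\bigl(\deg_z f,\ \nu_2(f(z))\bigr)\qquad\text{for all } z\in\mathbb{CP}^1,$$ where $\deg_z f$ is the local degree of $f$ at $z$. Rational functions are *conjugate* if they are conjugate by a Möbius transformation, $T_d$ denotes the Chebyshev polynomial, $T_d(\cos t)=\cos(dt)$, and $A^{\circ l}$ is the $l$-th iterate of $A$. **Theorem.** Let $A\in\mathbb C(z)$ be a rational function of degree at least two that is not conjugate to $z^{d}$, $z^{-d}$,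 $T_d$ or $-T_d$ for any $d\ge 2$. Then there exists an orbifold $\mathcal O_0^A$ such that $A:\mathcal O_0^A\to\mathcal O_0^A$ is a minimal holomorphic map, and every orbifold $\mathcal O$ for which $A:\mathcal O\to\mathcal O$ is a minimal holomorphic map satisfies $\mathcal O\preceq\mathcal O_0^A$. (Such an orbifold is unique.) Furthermore, for every $l\ge 1$ the orbifold $\mathcal O_0^{A^{\circ l}}$, characterized by the same properties for $A^{\circ l}$ in place of $A$, exists and $\mathcal O_0^{A^{\circ l}}=\mathcal O_0^A$. -/

import Mathlib

open scoped Polynomial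

namespace RationalOrbifold

noncomputable section

/-- The Riemann sphere `ℂℙ¹ = ℂ ∪ {∞}`. -/
abbrev Sphere : Type := OnePoint ℂ

/-- The degree of a rational function, written in lowest terms as `P / Q`:
the maximum of the degrees of `P` and `Q`. -/
def degree (A : RatFunc ℂ) : ℕ := max A.num.natDegree A.denom.natDegree

/-- The self-map of the Riemann sphere defined by a rational function `A = P / Q` in lowest terms.
At `∞` the value is the ratio of the coefficients of `z ^ deg A` in `P` and `Q`
(which is `∞` if this coefficient of `Q` vanishes). -/
def toMap (A : RatFunc ℂ) : Sphere → Sphere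
  | OnePoint.infty =>
      open Classical in
      if A.denom.coeff (degree A) = 0 then OnePoint.infty
      else ((A.num.coeff (degree A) / A.denom.coeff (degree A) : ℂ) : Sphere)
  | OnePoint.some z =>
      open Classical in
      if A.denom.eval z = 0 then OnePoint.infty
      else ((A.num.eval z / A.denom.eval z : ℂ) : Sphere)

/-- For `A = P / Q` in lowest terms, the polynomial whose zeros in `ℂ` are the finite solutions of
`A z = w`, counted with multiplicity: `P - w Q` for finite `w`, and `Q` for `w = ∞`. -/
def fiberPolynomial (A : RatFunc ℂ) : Sphere → ℂ[X]
  | OnePoint.infty => A.denom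
  | OnePoint.some w => A.num - Polynomial.C w * A.denom

/-- The multiplicity of the point `z` of the sphere as a solution of `A z = w`, for nonconstant `A`.
At `z = ∞` it is the drop of the degree of the fiber polynomial from its generic value `deg A`. -/
def fiberMultiplicity (A : RatFunc ℂ) (w : Sphere) : Sphere → ℕ
  | OnePoint.infty => degree A - (fiberPolynomial A w).natDegree
  | OnePoint.some z => (fiberPolynomial A w).rootMultiplicity z

/-- The local degree `deg_z A` of a nonconstant rational function `A` at a point `z` of the sphere:
the multiplicity with which `A` takes the value `A z` at `z`. -/
def localDegree (A : RatFunc ℂ) (z : Sphere) : ℕ := fiberMultiplicity A (toMap A z) z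

/-- The composition `A ∘ B` of rational functions (`B` nonconstant): substitution of `B`
for the variable in `A = P / Q`. -/
def comp (A B : RatFunc ℂ) : RatFunc ℂ :=
  Polynomial.aeval B A.num / Polynomial.aeval B A.denom

/-- The `l`-th iterate `A ∘ A ∘ ⋯ ∘ A`. -/
def iterate (A : RatFunc ℂ) (l : ℕ) : RatFunc ℂ := (comp A)^[l] RatFunc.X

/-- `A` and `B` are conjugate: `μ ∘ A = B ∘ μ` for a Möbius transformation `μ`, that is, for a
rational function `μ` of degree one. -/
def Conjugate (A B : RatFunc ℂ) : Prop :=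
  ∃ μ : RatFunc ℂ, degree μ = 1 ∧ comp μ A = comp B μ

/-- The Chebyshev polynomial `T_d`, `T_d (cos t) = cos (d t)`, as a rational function. -/
def chebyshev (d : ℕ) : RatFunc ℂ :=
  algebraMap ℂ[X] (RatFunc ℂ) (Polynomial.Chebyshev.T ℂ d)

/-- A good orbifold on the Riemann sphere: a ramification function with positive integer values,
equal to `1` outside a finite set, for which the set of points with `ν z ≠ 1` is not a single point,
and is not a pair of points at which `ν` takes different values. -/
@[ext]
structure Orbifold where
  ν : Sphere → ℕ
  pos : ∀ z, 0 < ν z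
  finite_singular : {z | ν z ≠ 1}.Finite
  not_one_point : ∀ z₁, {z | ν z ≠ 1} ≠ {z₁}
  two_points : ∀ z₁ z₂, {z | ν z ≠ 1} = {z₁, z₂} → ν z₁ = ν z₂

/-- The relation `O₁ ⪯ O₂`: `ν₁ z` divides `ν₂ z` at every point `z`. -/
def Orbifold.Precedes (O₁ O₂ : Orbifold) : Prop := ∀ z, O₁.ν z ∣ O₂.ν z

/-- `A : O₁ → O₂` is a minimal holomorphic map between orbifolds. -/
def IsMinimalHolomorphicMap (A : RatFunc ℂ) (O₁ O₂ : Orbifold) : Prop :=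
  ∀ z : Sphere,
    O₂.ν (toMap A z) = O₁.ν z * Nat.gcd (localDegree A z) (O₂.ν (toMap A z))

/-- `O` is a maximal orbifold `O₀^A` of `A`: `A : O → O` is a minimal holomorphic map, and every
orbifold `O'` for which `A : O' → O'` is a minimal holomorphic map satisfies `O' ⪯ O`. -/
def IsMaximalOrbifold (A : RatFunc ℂ) (O : Orbifold) : Prop :=
  IsMinimalHolomorphicMap A O O ∧
    ∀ O' : Orbifold, IsMinimalHolomorphicMap A O' O' → O'.Precedes O

end

end RationalOrbifold

/-!
The proof avoids Euler characteristics and the classification of orbifolds: it only uses the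
Riemann–Hurwitz inequality.

**Invariant orbifolds.** A map `A : O → O` is minimal holomorphic if and only if `O.ν` is fixed by
the pullback operator `ν ↦ (z ↦ ν (A z) / gcd (deg_z A) (ν (A z)))`. This operator commutes with
pointwise least common multiples, and by the chain rule for local degrees it turns composition
of rational functions into composition of operators. Hence the invariant orbifolds are closed under
least common multiples (`isMinimalHolomorphicMap_lcm`), and as soon as they have bounded weight, the
product of all `ν z`, one of maximal weight is a maximal one (`exists_isMaximalOrbifold`).

**Boundedness.** Let `d = deg A` and let `S` be the set of singular points of an invariant orbifold.
Then `A` maps `S` into itself, and every other preimage of a point of `S` has local degree at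
least two, so Riemann–Hurwitz gives `|S| ≤ 4` (`card_support_le_four`). If some `ν z` exceeds
`d ^ 4`, consider the sets `{ν > d ^ j}` for `0 ≤ j ≤ 4`: each contains the preimage of the next
one, so two successive ones coincide and form a completely invariant set `E`, which has at most two
points by Riemann–Hurwitz. If `E` has two points, `A` is conjugate to `z ^ d` or `z ^ (-d)`, as one
sees by comparing divisors. If `E = {w}`, the point `w` is totally ramified, and equality must hold
in the Riemann–Hurwitz estimate over the rest of `S`; goodness of the orbifold leaves only the
ramification pattern of Chebyshev polynomials (`exceptional_of_large_ramification`). A polynomial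
`b` with this pattern satisfies `(X ^ 2 - 1) * b' ^ 2 = d ^ 2 * (b ^ 2 - 1)`, and therefore the
Chebyshev differential equation, whose polynomial solutions are the multiples of `T_d`; so
`b = ± T_d` (`conjugate_chebyshev`).

**Iterates.** An orbifold invariant under `A` is invariant under its iterates. Conversely, if
`O` is invariant under the `l`-th iterate, the least common multiple of its first `l`
pullbacks along `A` is a good orbifold invariant under `A`, and it dominates `O`
(`exists_precedes_of_iterate`). So the maximal orbifold of `A` is maximal for every iterate, and
exceptional iterates need not be considered.

All local computations go through the order `ord p F` of a rational function `F` at a point `p` of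
the sphere and the formula `ord_z (F ∘ A) = deg_z A * ord_{A z} F` (`ord_comp`), from which the
chain rule follows.
-/

namespace RationalOrbifold

noncomputable section

open Polynomial

/-! ### Orders of vanishing of rational functions -/

/-- The order of vanishing of a rational function at a point of the sphere, negative at poles.
Junk value: `ord p 0 = 0`. -/
def ord (p : Sphere) (F : RatFunc ℂ) : ℤ :=
  match p with
  | OnePoint.infty => -F.intDegree
  | OnePoint.some z => (F.num.rootMultiplicity z : ℤ) - F.denom.rootMultiplicity z

lemma ord_infty (F : RatFunc ℂ) : ord OnePoint.infty F = -F.intDegree := rfl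

lemma ord_coe (z : ℂ) (F : RatFunc ℂ) :
    ord (z : Sphere) F = (F.num.rootMultiplicity z : ℤ) - F.denom.rootMultiplicity z := rfl

lemma ord_coe_div (z : ℂ) {P Q : ℂ[X]} (hP : P ≠ 0) (hQ : Q ≠ 0) :
    ord (z : Sphere) (algebraMap _ _ P / algebraMap _ _ Q : RatFunc ℂ) =
      (P.rootMultiplicity z : ℤ) - Q.rootMultiplicity z := by
  set F : RatFunc ℂ := algebraMap _ _ P / algebraMap _ _ Q with hF
  have hF0 : F ≠ 0 := div_ne_zero (by simpa using hP) (by simpa using hQ)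
  have h := (RatFunc.num_mul_eq_mul_denom_iff hQ).2 hF
  have hn := RatFunc.num_ne_zero hF0
  have hd := F.denom_ne_zero
  have h' := congrArg (rootMultiplicity z) h
  rw [rootMultiplicity_mul (mul_ne_zero hn hQ), rootMultiplicity_mul (mul_ne_zero hP hd)] at h'
  rw [ord_coe]
  omega

lemma ord_infty_div {P Q : ℂ[X]} (hP : P ≠ 0) (hQ : Q ≠ 0) :
    ord OnePoint.infty (algebraMap _ _ P / algebraMap _ _ Q : RatFunc ℂ) =
      (Q.natDegree : ℤ) - P.natDegree := by
  rw [ord_infty, RatFunc.intDegree_div (by simpa using hP) (by simpa using hQ),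
    RatFunc.intDegree_polynomial, RatFunc.intDegree_polynomial]
  ring

lemma ord_mul (p : Sphere) {F G : RatFunc ℂ} (hF : F ≠ 0) (hG : G ≠ 0) :
    ord p (F * G) = ord p F + ord p G := by
  have hFn := RatFunc.num_ne_zero hF
  have hGn := RatFunc.num_ne_zero hG
  have hFd := F.denom_ne_zero
  have hGd := G.denom_ne_zero
  induction p using OnePoint.rec with
  | infty => rw [ord_infty, RatFunc.intDegree_mul hF hG, ord_infty, ord_infty]; ring
  | coe z =>
    have h : F * G = algebraMap _ _ (F.num * G.num) / algebraMap _ _ (F.denom * G.denom) := by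
      conv_lhs => rw [← F.num_div_denom, ← G.num_div_denom]
      rw [map_mul, map_mul, div_mul_div_comm]
    rw [h, ord_coe_div z (mul_ne_zero hFn hGn) (mul_ne_zero hFd hGd),
      rootMultiplicity_mul (mul_ne_zero hFn hGn), rootMultiplicity_mul (mul_ne_zero hFd hGd),
      ord_coe, ord_coe]
    push_cast
    ring

@[simp]
lemma ord_C (p : Sphere) (c : ℂ) : ord p (RatFunc.C c) = 0 := by
  induction p using OnePoint.rec with
  | infty => simp [ord_infty]
  | coe z =>
    have h1 : (1 : ℂ[X]).rootMultiplicity z = 0 := rootMultiplicity_C 1 z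
    rw [ord_coe, RatFunc.num_C, RatFunc.denom_C, rootMultiplicity_C, h1, sub_self]

@[simp]
lemma ord_one (p : Sphere) : ord p 1 = 0 := by
  simpa using ord_C p 1

lemma ord_inv (p : Sphere) (F : RatFunc ℂ) : ord p F⁻¹ = -ord p F := by
  by_cases hF : F = 0
  · have h := ord_C p 0
    rw [map_zero] at h
    rw [hF, inv_zero, h, neg_zero]
  · have h := ord_mul p hF (inv_ne_zero hF)
    rw [mul_inv_cancel₀ hF, ord_one] at h
    omega

lemma ord_pow (p : Sphere) {F : RatFunc ℂ} (hF : F ≠ 0) (n : ℕ) :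
    ord p (F ^ n) = n * ord p F := by
  induction n with
  | zero => simp
  | succ n ih => rw [pow_succ, ord_mul p (pow_ne_zero n hF) hF, ih]; push_cast; ring

/-- A rational function is determined by its divisor up to a constant factor. -/
lemma exists_eq_C_mul_of_ord_eq {F G : RatFunc ℂ} (hF : F ≠ 0) (hG : G ≠ 0)
    (h : ∀ p, ord p F = ord p G) : ∃ c : ℂ, c ≠ 0 ∧ F = RatFunc.C c * G := by
  set H := F * G⁻¹ with hH
  have hH0 : H ≠ 0 := mul_ne_zero hF (inv_ne_zero hG)
  have h0 : ∀ z : ℂ, H.num.rootMultiplicity z = H.denom.rootMultiplicity z := by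
    intro z
    have : ord (z : Sphere) H = 0 := by
      rw [hH, ord_mul _ hF (inv_ne_zero hG), ord_inv, h]; ring
    rw [ord_coe] at this
    omega
  have hn := RatFunc.num_ne_zero hH0
  have hd := H.denom_ne_zero
  have hassoc : Associated H.num H.denom := by
    rw [IsAlgClosed.associated_iff_roots_eq_roots hn hd]
    ext z
    rw [count_roots, count_roots, h0]
  have hunit : IsUnit H.denom :=
    H.isCoprime_num_denom.isUnit_of_dvd' hassoc.symm.dvd dvd_rfl
  have hunit' : IsUnit H.num := H.isCoprime_num_denom.isUnit_of_dvd' dvd_rfl hassoc.dvd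
  obtain ⟨a, ha, hna⟩ := Polynomial.isUnit_iff.1 hunit'
  obtain ⟨b, hb, hdb⟩ := Polynomial.isUnit_iff.1 hunit
  refine ⟨a / b, div_ne_zero ha.ne_zero hb.ne_zero, ?_⟩
  have : H = RatFunc.C (a / b) := by
    rw [← H.num_div_denom, ← hna, ← hdb, map_div₀]
    rfl
  rw [← this, hH, inv_mul_cancel_right₀ hG]

/-! ### Local degrees through orders of vanishing -/

lemma natDegree_num_le (A : RatFunc ℂ) : A.num.natDegree ≤ degree A := le_max_left _ _

lemma natDegree_denom_le (A : RatFunc ℂ) : A.denom.natDegree ≤ degree A := le_max_right _ _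

lemma sub_C_eq_div (A : RatFunc ℂ) (a : ℂ) :
    A - RatFunc.C a =
      algebraMap _ _ (A.num - Polynomial.C a * A.denom) / algebraMap _ _ A.denom := by
  have hd : (algebraMap ℂ[X] (RatFunc ℂ) A.denom) ≠ 0 := by simpa using A.denom_ne_zero
  conv_lhs => rw [← A.num_div_denom]
  rw [eq_div_iff hd, sub_mul, div_mul_cancel₀ _ hd, map_sub, map_mul]
  rfl

lemma ne_C_of_degree_pos {A : RatFunc ℂ} (hA : 1 ≤ degree A) (a : ℂ) : A ≠ RatFunc.C a := by
  rintro rfl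
  simp [degree] at hA

lemma sub_C_ne_zero {A : RatFunc ℂ} (hA : 1 ≤ degree A) (a : ℂ) : A - RatFunc.C a ≠ 0 :=
  sub_ne_zero.2 (ne_C_of_degree_pos hA a)

lemma ne_zero_of_degree_pos {A : RatFunc ℂ} (hA : 1 ≤ degree A) : A ≠ 0 := by
  simpa using ne_C_of_degree_pos hA 0

lemma degree_pos_of_ne_C {A : RatFunc ℂ} (hA : ∀ a : ℂ, A ≠ RatFunc.C a) : 1 ≤ degree A := by
  by_contra h
  have hn : A.num.natDegree = 0 := by have := natDegree_num_le A; omega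
  have hd : A.denom.natDegree = 0 := by have := natDegree_denom_le A; omega
  obtain ⟨a, ha⟩ := Polynomial.natDegree_eq_zero.1 hn
  obtain ⟨b, hb⟩ := Polynomial.natDegree_eq_zero.1 hd
  refine hA (a / b) ?_
  rw [← A.num_div_denom, ← ha, ← hb, map_div₀]
  rfl

lemma fiberPolynomial_ne_zero {A : RatFunc ℂ} (hA : 1 ≤ degree A) (w : Sphere) :
    fiberPolynomial A w ≠ 0 := by
  induction w using OnePoint.rec with
  | infty => exact A.denom_ne_zero
  | coe a =>
    intro h
    apply sub_C_ne_zero hA a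
    change A.num - Polynomial.C a * A.denom = 0 at h
    rw [sub_C_eq_div, h, map_zero, zero_div]

lemma natDegree_fiberPolynomial_le (A : RatFunc ℂ) (w : Sphere) :
    (fiberPolynomial A w).natDegree ≤ degree A := by
  induction w using OnePoint.rec with
  | infty => exact natDegree_denom_le A
  | coe a =>
    refine (natDegree_sub_le _ _).trans (max_le (natDegree_num_le A) ?_)
    exact (natDegree_C_mul_le _ _).trans (natDegree_denom_le A)

lemma not_eval_num_denom (A : RatFunc ℂ) (z : ℂ) (hn : A.num.eval z = 0) :
    A.denom.eval z ≠ 0 := by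
  intro hd
  obtain ⟨u, v, huv⟩ := A.isCoprime_num_denom
  have := congrArg (Polynomial.eval z) huv
  simp [hn, hd] at this

lemma toMap_coe (A : RatFunc ℂ) (z : ℂ) : toMap A (z : Sphere) =
    if A.denom.eval z = 0 then OnePoint.infty
      else ((A.num.eval z / A.denom.eval z : ℂ) : Sphere) := by
  classical
  change (if _ then _ else _) = _
  congr

lemma toMap_infty (A : RatFunc ℂ) : toMap A OnePoint.infty =
    if A.denom.coeff (degree A) = 0 then OnePoint.infty
      else ((A.num.coeff (degree A) / A.denom.coeff (degree A) : ℂ) : Sphere) := by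
  classical
  change (if _ then _ else _) = _
  congr

lemma coeff_num_degree_ne_zero (A : RatFunc ℂ)
    (hd : A.denom.coeff (degree A) = 0) : A.num.coeff (degree A) ≠ 0 := by
  rcases le_total A.num.natDegree A.denom.natDegree with h | h
  · have h2 : degree A = A.denom.natDegree := max_eq_right h
    rw [h2, coeff_natDegree] at hd
    exact absurd (leadingCoeff_eq_zero.1 hd) A.denom_ne_zero
  · have h2 : degree A = A.num.natDegree := max_eq_left h
    rw [h2, coeff_natDegree]
    intro h0
    rw [leadingCoeff_eq_zero] at h0
    rw [h2] at hd
    rw [h0, natDegree_zero, Nat.le_zero] at h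
    rw [h0, natDegree_zero, ← h, coeff_natDegree, leadingCoeff_eq_zero] at hd
    exact A.denom_ne_zero hd

lemma toMap_coe_eq_infty_iff (A : RatFunc ℂ) (z : ℂ) :
    toMap A (z : Sphere) = OnePoint.infty ↔ A.denom.eval z = 0 := by
  rw [toMap_coe]; split <;> simp_all

lemma toMap_infty_eq_infty_iff (A : RatFunc ℂ) :
    toMap A OnePoint.infty = OnePoint.infty ↔ A.denom.coeff (degree A) = 0 := by
  rw [toMap_infty]; split <;> simp_all

lemma toMap_coe_eq_coe_iff (A : RatFunc ℂ) (z a : ℂ) :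
    toMap A (z : Sphere) = a ↔ (fiberPolynomial A a).eval z = 0 := by
  change _ ↔ (A.num - Polynomial.C a * A.denom).eval z = 0
  rw [toMap_coe]
  split
  case isTrue h =>
    have : A.num.eval z ≠ 0 := fun hn => not_eval_num_denom A z hn h
    simp [h, this]
  case isFalse h =>
    rw [OnePoint.coe_eq_coe, div_eq_iff h]
    simp [sub_eq_zero]

lemma toMap_infty_eq_coe_iff (A : RatFunc ℂ) (a : ℂ) :
    toMap A OnePoint.infty = a ↔ (fiberPolynomial A a).coeff (degree A) = 0 := by
  change _ ↔ (A.num - Polynomial.C a * A.denom).coeff (degree A) = 0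
  rw [toMap_infty]
  split
  case isTrue h =>
    have := coeff_num_degree_ne_zero A h
    simp [h, this]
  case isFalse h =>
    rw [OnePoint.coe_eq_coe, div_eq_iff h]
    simp [sub_eq_zero]

lemma toMap_coe_eq_iff (A : RatFunc ℂ) (z : ℂ) (w : Sphere) :
    toMap A (z : Sphere) = w ↔ (fiberPolynomial A w).eval z = 0 := by
  induction w using OnePoint.rec with
  | infty => exact toMap_coe_eq_infty_iff A z
  | coe a => exact toMap_coe_eq_coe_iff A z a

lemma toMap_infty_eq_iff (A : RatFunc ℂ) (w : Sphere) :
    toMap A OnePoint.infty = w ↔ (fiberPolynomial A w).coeff (degree A) = 0 := by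
  induction w using OnePoint.rec with
  | infty => exact toMap_infty_eq_infty_iff A
  | coe a => exact toMap_infty_eq_coe_iff A a

lemma fiberMultiplicity_coe (A : RatFunc ℂ) (w : Sphere) (z : ℂ) :
    fiberMultiplicity A w (z : Sphere) = (fiberPolynomial A w).rootMultiplicity z := rfl

lemma fiberMultiplicity_infty (A : RatFunc ℂ) (w : Sphere) :
    fiberMultiplicity A w OnePoint.infty = degree A - (fiberPolynomial A w).natDegree := rfl

lemma fiberMultiplicity_pos_iff {A : RatFunc ℂ} (hA : 1 ≤ degree A) (w z : Sphere) :
    0 < fiberMultiplicity A w z ↔ toMap A z = w := by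
  have h0 := fiberPolynomial_ne_zero hA w
  have hle := natDegree_fiberPolynomial_le A w
  induction z using OnePoint.rec with
  | infty =>
    rw [toMap_infty_eq_iff, fiberMultiplicity_infty, Nat.sub_pos_iff_lt]
    constructor
    · exact coeff_eq_zero_of_natDegree_lt
    · intro h
      refine lt_of_le_of_ne hle fun heq => h0 ?_
      rwa [← heq, coeff_natDegree, leadingCoeff_eq_zero] at h
  | coe z =>
    rw [toMap_coe_eq_iff, fiberMultiplicity_coe, rootMultiplicity_pos h0]
    rfl

lemma localDegree_pos {A : RatFunc ℂ} (hA : 1 ≤ degree A) (z : Sphere) : 0 < localDegree A z :=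
  (fiberMultiplicity_pos_iff hA _ _).2 rfl

lemma localDegree_eq_fiberMultiplicity (A : RatFunc ℂ) {z w : Sphere} (h : toMap A z = w) :
    localDegree A z = fiberMultiplicity A w z := by
  subst h; rfl

lemma ord_sub_C_eq (A : RatFunc ℂ) (hA : 1 ≤ degree A) (a : ℂ) (z : Sphere) :
    ord z (A - RatFunc.C a) =
      (fiberMultiplicity A a z : ℤ) - fiberMultiplicity A OnePoint.infty z := by
  have h0 := fiberPolynomial_ne_zero hA (a : Sphere)
  have h0' := fiberPolynomial_ne_zero hA OnePoint.infty
  have hle := natDegree_fiberPolynomial_le A (a : Sphere)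
  have hle' := natDegree_fiberPolynomial_le A OnePoint.infty
  have h : A - RatFunc.C a = algebraMap _ _ (fiberPolynomial A a) /
    algebraMap _ _ (fiberPolynomial A OnePoint.infty) := sub_C_eq_div A a
  rw [h]
  induction z using OnePoint.rec with
  | infty =>
    rw [ord_infty_div h0 h0', fiberMultiplicity_infty, fiberMultiplicity_infty]
    omega
  | coe z => rw [ord_coe_div z h0 h0', fiberMultiplicity_coe, fiberMultiplicity_coe]

open Classical in
lemma ord_X_sub_C (a : ℂ) (w : Sphere) :
    ord w (RatFunc.X - RatFunc.C a) =
      if w = a then 1 else if w = OnePoint.infty then -1 else 0 := by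
  have h : (RatFunc.X - RatFunc.C a : RatFunc ℂ) =
      algebraMap _ _ (X - Polynomial.C a) / algebraMap _ _ (1 : ℂ[X]) := by
    rw [map_sub, map_one, div_one, RatFunc.algebraMap_X]; rfl
  rw [h]
  induction w using OnePoint.rec with
  | infty => rw [ord_infty_div (X_sub_C_ne_zero a) one_ne_zero]; simp
  | coe z =>
    have h1 : (1 : ℂ[X]).rootMultiplicity z = 0 := rootMultiplicity_C 1 z
    rw [ord_coe_div z (X_sub_C_ne_zero a) one_ne_zero, rootMultiplicity_X_sub_C, h1]
    simp

lemma ord_sub_C {A : RatFunc ℂ} (hA : 1 ≤ degree A) (a : ℂ) (z : Sphere) :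
    ord z (A - RatFunc.C a) =
      localDegree A z * ord (toMap A z) (RatFunc.X - RatFunc.C a) := by
  have hz : ∀ w, toMap A z ≠ w → fiberMultiplicity A w z = 0 := by
    intro w hw
    by_contra h
    exact hw ((fiberMultiplicity_pos_iff hA w z).1 (Nat.pos_of_ne_zero h))
  rw [ord_sub_C_eq A hA, ord_X_sub_C]
  split_ifs with h1 h2
  · rw [hz OnePoint.infty (by rw [h1]; simp), localDegree_eq_fiberMultiplicity A h1]
    simp
  · rw [hz a h1, localDegree_eq_fiberMultiplicity A h2]
    simp
  · rw [hz _ h1, hz _ h2]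
    simp

lemma toMap_eq_coe_iff_ord {A : RatFunc ℂ} (hA : 1 ≤ degree A) (a : ℂ) (z : Sphere) :
    toMap A z = a ↔ 0 < ord z (A - RatFunc.C a) := by
  have he := localDegree_pos hA z
  rw [ord_sub_C hA, ord_X_sub_C]
  split_ifs with h1 h2
  · simpa [h1] using he
  · simp [h1]
  · simp [h1]

lemma toMap_eq_infty_iff_ord {A : RatFunc ℂ} (hA : 1 ≤ degree A) (z : Sphere) :
    toMap A z = OnePoint.infty ↔ ord z A < 0 := by
  have he := localDegree_pos hA z
  have h := ord_sub_C hA 0 z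
  rw [map_zero, sub_zero] at h
  rw [h, ← map_zero (RatFunc.C (K := ℂ)), ord_X_sub_C]
  split_ifs with h1 h2
  · simp [h1]
  · simpa [h2] using he
  · simp [h2]

/-! ### Composition and the chain rule -/

lemma transcendental_of_degree_pos {A : RatFunc ℂ} (hA : 1 ≤ degree A) : Transcendental ℂ A :=
  RatFunc.transcendental_of_ne_C A fun ⟨c, hc⟩ => ne_C_of_degree_pos hA c hc

lemma nonZeroDivisors_le_comap_aeval {B : RatFunc ℂ} (hB : Transcendental ℂ B) :
    nonZeroDivisors ℂ[X] ≤ (nonZeroDivisors (RatFunc ℂ)).comap (Polynomial.aeval B) :=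
  nonZeroDivisors_le_comap_nonZeroDivisors_of_injective _
    (transcendental_iff_injective.1 hB)

/-- Substitution of a nonconstant rational function `B` for the variable, as a homomorphism
of fields over `ℂ`. -/
def compHom (B : RatFunc ℂ) (hB : 1 ≤ degree B) : RatFunc ℂ →ₐ[ℂ] RatFunc ℂ :=
  RatFunc.liftAlgHom (Polynomial.aeval B)
    (nonZeroDivisors_le_comap_aeval (transcendental_of_degree_pos hB))

lemma compHom_apply (B : RatFunc ℂ) (hB : 1 ≤ degree B) (A : RatFunc ℂ) :
    compHom B hB A = comp A B :=
  RatFunc.liftAlgHom_apply _ _ _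

lemma comp_X_left (B : RatFunc ℂ) : comp RatFunc.X B = B := by simp [comp]

lemma comp_C_left (c : ℂ) (B : RatFunc ℂ) : comp (RatFunc.C c) B = RatFunc.C c := by
  simp [comp, RatFunc.algebraMap_eq_C]

lemma comp_algebraMap_left (P : ℂ[X]) (B : RatFunc ℂ) :
    comp (algebraMap _ _ P) B = Polynomial.aeval B P := by simp [comp]

lemma comp_X_right (A : RatFunc ℂ) : comp A RatFunc.X = A := by
  have h : ∀ P : ℂ[X], Polynomial.aeval (RatFunc.X : RatFunc ℂ) P = algebraMap _ _ P := by
    intro P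
    rw [← RatFunc.algebraMap_X, Polynomial.aeval_algebraMap_apply, Polynomial.aeval_X_left_apply]
  rw [comp, h, h, RatFunc.num_div_denom]

lemma comp_ne_zero {A B : RatFunc ℂ} (hA : A ≠ 0) (hB : 1 ≤ degree B) : comp A B ≠ 0 := by
  rw [← compHom_apply B hB]
  simpa using hA

lemma degree_comp_pos {A B : RatFunc ℂ} (hA : 1 ≤ degree A) (hB : 1 ≤ degree B) :
    1 ≤ degree (comp A B) := by
  refine degree_pos_of_ne_C fun a h => ?_
  refine ne_C_of_degree_pos hA a ((compHom B hB).injective ?_)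
  change compHom B hB A = compHom B hB (RatFunc.C a)
  rw [compHom_apply, compHom_apply, comp_C_left, h]

lemma ord_aeval {A : RatFunc ℂ} (hA : 1 ≤ degree A) (z : Sphere) (P : ℂ[X]) :
    ord z (Polynomial.aeval A P) =
      localDegree A z * ord (toMap A z) (algebraMap _ _ P : RatFunc ℂ) := by
  induction h : P.natDegree generalizing P with
  | zero =>
    obtain ⟨c, rfl⟩ := Polynomial.natDegree_eq_zero.1 h
    rw [Polynomial.aeval_C, RatFunc.algebraMap_eq_C, ord_C, RatFunc.algebraMap_C, ord_C, mul_zero]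
  | succ n ih =>
    have hP : P ≠ 0 := by rintro rfl; simp at h
    obtain ⟨a, ha⟩ := IsAlgClosed.exists_root P (by
      rw [Polynomial.degree_eq_natDegree hP, h]; exact_mod_cast n.succ_ne_zero)
    obtain ⟨Q, rfl⟩ := dvd_iff_isRoot.2 ha
    have hQ : Q ≠ 0 := right_ne_zero_of_mul hP
    have hQn : Q.natDegree = n := by
      rw [natDegree_mul (X_sub_C_ne_zero a) hQ, natDegree_X_sub_C] at h
      omega
    have h1 : Polynomial.aeval A Q ≠ 0 :=
      fun h0 => hQ (transcendental_iff.1 (transcendental_of_degree_pos hA) Q h0)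
    have h2 : Polynomial.aeval A (X - Polynomial.C a) = A - RatFunc.C a := by
      simp [RatFunc.algebraMap_eq_C]
    have h3 : (algebraMap _ _ (X - Polynomial.C a) : RatFunc ℂ) = RatFunc.X - RatFunc.C a := by
      simp
    rw [map_mul, map_mul, ord_mul z (h2 ▸ sub_C_ne_zero hA a) h1, ih Q hQn, h2, ord_sub_C hA,
      ord_mul _ (RatFunc.algebraMap_ne_zero (X_sub_C_ne_zero a)) (by simpa using hQ), h3]
    ring

/-- Pulling back a function by `A` multiplies orders of vanishing by local degrees. -/
lemma ord_comp {A F : RatFunc ℂ} (hA : 1 ≤ degree A) (hF : F ≠ 0) (z : Sphere) :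
    ord z (comp F A) = localDegree A z * ord (toMap A z) F := by
  have ht := transcendental_iff.1 (transcendental_of_degree_pos hA)
  have hn := RatFunc.num_ne_zero hF
  have hd := F.denom_ne_zero
  conv_rhs => rw [← F.num_div_denom]
  rw [comp, div_eq_mul_inv, div_eq_mul_inv,
    ord_mul _ (fun h => hn (ht _ h)) (inv_ne_zero fun h => hd (ht _ h)),
    ord_mul _ (by simpa using hn) (by simpa using hd), ord_inv, ord_inv, ord_aeval hA,
    ord_aeval hA]
  ring

lemma comp_sub_C {A B : RatFunc ℂ} (hB : 1 ≤ degree B) (a : ℂ) :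
    comp (A - RatFunc.C a) B = comp A B - RatFunc.C a := by
  rw [← compHom_apply B hB, map_sub, compHom_apply, compHom_apply, comp_C_left]

lemma toMap_comp {A B : RatFunc ℂ} (hA : 1 ≤ degree A) (hB : 1 ≤ degree B) (z : Sphere) :
    toMap (comp A B) z = toMap A (toMap B z) := by
  have he : (0 : ℤ) < localDegree B z := by exact_mod_cast localDegree_pos hB z
  have hAB := degree_comp_pos hA hB
  rcases hw : toMap A (toMap B z) with _ | a
  · change _ = OnePoint.infty
    have hw' : toMap A (toMap B z) = OnePoint.infty := hw
    rw [toMap_eq_infty_iff_ord hA] at hw'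
    rw [toMap_eq_infty_iff_ord hAB, ord_comp hB (ne_zero_of_degree_pos hA)]
    exact mul_neg_of_pos_of_neg he hw'
  · change _ = (a : Sphere)
    have hw' : toMap A (toMap B z) = (a : Sphere) := hw
    rw [toMap_eq_coe_iff_ord hA] at hw'
    rw [toMap_eq_coe_iff_ord hAB, ← comp_sub_C hB, ord_comp hB (sub_C_ne_zero hA a)]
    exact mul_pos he hw'

lemma localDegree_comp {A B : RatFunc ℂ} (hA : 1 ≤ degree A) (hB : 1 ≤ degree B) (z : Sphere) :
    localDegree (comp A B) z = localDegree B z * localDegree A (toMap B z) := by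
  have hAB := degree_comp_pos hA hB
  -- A constant `a` at which `X - a` has nonzero order at the common image point.
  obtain ⟨a, ha⟩ : ∃ a : ℂ, ord (toMap A (toMap B z)) (RatFunc.X - RatFunc.C a) ≠ 0 := by
    rcases hw : toMap A (toMap B z) with _ | a
    · exact ⟨0, by change ord OnePoint.infty _ ≠ 0; rw [ord_X_sub_C]; simp⟩
    · exact ⟨a, by change ord (a : Sphere) _ ≠ 0; rw [ord_X_sub_C]; simp⟩
  have h := ord_sub_C hAB a z
  rw [← comp_sub_C hB, ord_comp hB (sub_C_ne_zero hA a), ord_sub_C hA, toMap_comp hA hB,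
    ← mul_assoc] at h
  exact_mod_cast (mul_right_cancel₀ ha h).symm

/-! ### Fibers and the Riemann–Hurwitz inequality -/

lemma toMap_eq_iff_fiberMultiplicity_ne_zero {A : RatFunc ℂ} (hA : 1 ≤ degree A) (w z : Sphere) :
    toMap A z = w ↔ fiberMultiplicity A w z ≠ 0 := by
  rw [← fiberMultiplicity_pos_iff hA, Nat.pos_iff_ne_zero]

open Classical in
lemma exists_finset_sum_fiberMultiplicity {A : RatFunc ℂ} (hA : 1 ≤ degree A) (w : Sphere) :
    ∃ T : Finset Sphere, (∀ z, toMap A z = w → z ∈ T) ∧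
      ∑ z ∈ T, fiberMultiplicity A w z = degree A := by
  set R := fiberPolynomial A w with hR
  refine ⟨insert OnePoint.infty (R.roots.toFinset.map ⟨_, OnePoint.coe_injective⟩), ?_, ?_⟩
  · intro z hz
    induction z using OnePoint.rec with
    | infty => exact Finset.mem_insert_self _ _
    | coe z =>
      refine Finset.mem_insert_of_mem (Finset.mem_map_of_mem _ ?_)
      rw [Multiset.mem_toFinset, mem_roots (fiberPolynomial_ne_zero hA w)]
      exact (toMap_coe_eq_iff A z w).1 hz
  · rw [Finset.sum_insert (by simp), Finset.sum_map, fiberMultiplicity_infty]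
    have h : ∑ z ∈ R.roots.toFinset, R.rootMultiplicity z = R.natDegree := by
      rw [← splits_iff_card_roots.1 (IsAlgClosed.splits R),
        ← Multiset.toFinset_sum_count_eq R.roots]
      exact Finset.sum_congr rfl fun z _ => (count_roots R).symm
    change degree A - R.natDegree + ∑ z ∈ R.roots.toFinset, R.rootMultiplicity z = _
    rw [h]
    exact Nat.sub_add_cancel (natDegree_fiberPolynomial_le A w)

lemma finite_fiber {A : RatFunc ℂ} (hA : 1 ≤ degree A) (w : Sphere) :
    {z | toMap A z = w}.Finite := by
  obtain ⟨T, hT, -⟩ := exists_finset_sum_fiberMultiplicity hA w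
  exact T.finite_toSet.subset fun z hz => hT z hz

/-- The fiber of a nonconstant rational function over a point, as a finite set. -/
def fiber (A : RatFunc ℂ) (hA : 1 ≤ degree A) (w : Sphere) : Finset Sphere :=
  (finite_fiber hA w).toFinset

@[simp]
lemma mem_fiber {A : RatFunc ℂ} (hA : 1 ≤ degree A) (w z : Sphere) :
    z ∈ fiber A hA w ↔ toMap A z = w := by
  simp [fiber]

lemma sum_localDegree_fiber {A : RatFunc ℂ} (hA : 1 ≤ degree A) (w : Sphere) :
    ∑ z ∈ fiber A hA w, localDegree A z = degree A := by
  obtain ⟨T, hT, hsum⟩ := exists_finset_sum_fiberMultiplicity hA w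
  rw [← hsum]
  rw [Finset.sum_congr rfl fun z hz =>
    localDegree_eq_fiberMultiplicity A ((mem_fiber hA w z).1 hz)]
  refine Finset.sum_subset (fun z hz => hT z ((mem_fiber hA w z).1 hz)) fun z _ hz => ?_
  by_contra h
  exact hz ((mem_fiber hA w z).2 ((toMap_eq_iff_fiberMultiplicity_ne_zero hA w z).2 h))

lemma toMap_surjective {A : RatFunc ℂ} (hA : 1 ≤ degree A) : Function.Surjective (toMap A) := by
  intro w
  have h := sum_localDegree_fiber hA w
  have hne : (fiber A hA w).Nonempty := by
    rw [Finset.nonempty_iff_ne_empty]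
    intro h0
    rw [h0, Finset.sum_empty] at h
    omega
  obtain ⟨z, hz⟩ := hne
  exact ⟨z, (mem_fiber hA w z).1 hz⟩

lemma localDegree_le {A : RatFunc ℂ} (hA : 1 ≤ degree A) (z : Sphere) :
    localDegree A z ≤ degree A := by
  rw [← sum_localDegree_fiber hA (toMap A z)]
  exact Finset.single_le_sum (f := localDegree A) (fun _ _ => Nat.zero_le _)
    ((mem_fiber hA _ z).2 rfl)

lemma localDegree_eq_degree_of_fiber {A : RatFunc ℂ} (hA : 1 ≤ degree A) {z w : Sphere}
    (h : ∀ x, toMap A x = w ↔ x = z) : localDegree A z = degree A := by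
  rw [← sum_localDegree_fiber hA w]
  have : fiber A hA w = {z} := by ext x; simp [h]
  rw [this, Finset.sum_singleton]

open Classical in
/-- The full preimage of a finite set of points under a nonconstant rational function. -/
def preimage (A : RatFunc ℂ) (hA : 1 ≤ degree A) (S : Finset Sphere) : Finset Sphere :=
  S.biUnion (fiber A hA)

@[simp]
lemma mem_preimage {A : RatFunc ℂ} (hA : 1 ≤ degree A) (S : Finset Sphere) (z : Sphere) :
    z ∈ preimage A hA S ↔ toMap A z ∈ S := by
  simp [preimage]

lemma sum_localDegree_preimage {A : RatFunc ℂ} (hA : 1 ≤ degree A) (S : Finset Sphere) :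
    ∑ z ∈ preimage A hA S, localDegree A z = S.card * degree A := by
  classical
  rw [preimage, Finset.sum_biUnion]
  · rw [Finset.sum_congr rfl fun w _ => sum_localDegree_fiber hA w, Finset.sum_const, smul_eq_mul]
  · intro w _ w' _ hne
    rw [Function.onFun, Finset.disjoint_left]
    intro z hz hz'
    rw [mem_fiber] at hz hz'
    exact hne (hz.symm.trans hz')

/-- The Wronskian of numerator and denominator can be computed with the fiber polynomial of any
value in place of one of them; this makes its zeros along that fiber visible. -/
lemma wronskian_fiberPolynomial (A : RatFunc ℂ) (w : Sphere) :
    ∃ G : ℂ[X], G.natDegree ≤ degree A ∧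
      wronskian A.num A.denom = wronskian (fiberPolynomial A w) G := by
  induction w using OnePoint.rec with
  | infty =>
    refine ⟨-A.num, by rw [natDegree_neg]; exact natDegree_num_le A, ?_⟩
    rw [wronskian_neg_right, wronskian_neg_eq]
    rfl
  | coe a =>
    refine ⟨A.denom, natDegree_denom_le A, ?_⟩
    change _ = wronskian (A.num - Polynomial.C a * A.denom) _
    simp only [wronskian, derivative_sub, derivative_mul, derivative_C]
    ring

lemma wronskian_num_denom_ne_zero {A : RatFunc ℂ} (hA : 1 ≤ degree A) :
    wronskian A.num A.denom ≠ 0 := by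
  intro h
  obtain ⟨hn, hd⟩ := (A.isCoprime_num_denom.wronskian_eq_zero_iff).1 h
  rw [derivative_eq_zero] at hn hd
  simp only [degree] at hA
  omega

lemma sub_one_le_rootMultiplicity_wronskian {F G : ℂ[X]} (hW : wronskian F G ≠ 0) (z : ℂ) :
    F.rootMultiplicity z - 1 ≤ (wronskian F G).rootMultiplicity z := by
  rw [le_rootMultiplicity_iff hW, wronskian]
  refine dvd_sub ?_ ?_
  · exact ((pow_dvd_pow _ (Nat.sub_le _ _)).trans (pow_rootMultiplicity_dvd F z)).mul_right _
  · exact ((pow_dvd_pow _ (rootMultiplicity_sub_one_le_derivative_rootMultiplicity F z)).trans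
      (pow_rootMultiplicity_dvd (derivative F) z)).mul_right _

lemma localDegree_sub_one_le_rootMultiplicity {A : RatFunc ℂ} (hA : 1 ≤ degree A) (z : ℂ) :
    localDegree A (z : Sphere) - 1 ≤ (wronskian A.num A.denom).rootMultiplicity z := by
  have hW := wronskian_num_denom_ne_zero hA
  obtain ⟨G, -, h⟩ := wronskian_fiberPolynomial A (toMap A z)
  rw [h] at hW ⊢
  exact sub_one_le_rootMultiplicity_wronskian hW z

lemma natDegree_wronskian_add_localDegree_lt {A : RatFunc ℂ} (hA : 1 ≤ degree A) :
    (wronskian A.num A.denom).natDegree + localDegree A OnePoint.infty < 2 * degree A := by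
  have hW := wronskian_num_denom_ne_zero hA
  obtain ⟨G, hG, h⟩ := wronskian_fiberPolynomial A (toMap A OnePoint.infty)
  have hR := natDegree_fiberPolynomial_le A (toMap A OnePoint.infty)
  have hlt : (wronskian A.num A.denom).natDegree <
      (fiberPolynomial A (toMap A OnePoint.infty)).natDegree + G.natDegree := by
    rw [h] at hW ⊢
    exact natDegree_wronskian_lt_add hW
  rw [localDegree, fiberMultiplicity_infty]
  omega

/-- The Riemann–Hurwitz inequality: the total ramification of a rational function of degree `d`
over any finite set of points is at most `2d - 2`. -/
lemma sum_localDegree_sub_one_le {A : RatFunc ℂ} (hA : 1 ≤ degree A) (T : Finset Sphere) :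
    ∑ z ∈ T, (localDegree A z - 1) ≤ 2 * degree A - 2 := by
  classical
  set W := wronskian A.num A.denom with hWdef
  have hfin : ∀ U : Finset ℂ, ∑ z ∈ U, (localDegree A (z : Sphere) - 1) ≤ W.natDegree := by
    intro U
    calc ∑ z ∈ U, (localDegree A (z : Sphere) - 1) ≤ ∑ z ∈ U, W.roots.count z := by
          refine Finset.sum_le_sum fun z _ => ?_
          rw [count_roots]
          exact localDegree_sub_one_le_rootMultiplicity hA z
      _ ≤ ∑ z ∈ U ∪ W.roots.toFinset, W.roots.count z :=
          Finset.sum_le_sum_of_subset Finset.subset_union_left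
      _ = W.roots.card := Multiset.sum_count_eq_card fun z hz => by simp_all
      _ ≤ W.natDegree := card_roots' W
  set U : Finset ℂ := T.preimage _ OnePoint.coe_injective.injOn with hU
  have hT : T ⊆ insert OnePoint.infty (U.map ⟨_, OnePoint.coe_injective⟩) := by
    intro z hz
    induction z using OnePoint.rec with
    | infty => exact Finset.mem_insert_self _ _
    | coe z => exact Finset.mem_insert_of_mem (Finset.mem_map_of_mem _ (by simpa [hU] using hz))
  have h1 := natDegree_wronskian_add_localDegree_lt hA
  rw [← hWdef] at h1
  have h2 := hfin U
  have h3 := localDegree_pos hA OnePoint.infty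
  calc ∑ z ∈ T, (localDegree A z - 1)
      ≤ ∑ z ∈ insert OnePoint.infty (U.map ⟨_, OnePoint.coe_injective⟩),
          (localDegree A z - 1) := Finset.sum_le_sum_of_subset hT
    _ = (localDegree A OnePoint.infty - 1) + ∑ z ∈ U, (localDegree A (z : Sphere) - 1) := by
        rw [Finset.sum_insert (by simp), Finset.sum_map]
        rfl
    _ ≤ 2 * degree A - 2 := by omega

/-! ### Pulling back ramification functions -/

/-- The ramification that a point of local degree `e` acquires from a point of ramification `n`:
`n / gcd e n`, written as `lcm e n / e`, which makes the compatibility with least common multiples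
evident. -/
def pull (e n : ℕ) : ℕ := Nat.lcm e n / e

lemma mul_pull (e n : ℕ) : e * pull e n = Nat.lcm e n :=
  Nat.mul_div_cancel' (Nat.dvd_lcm_left e n)

lemma pull_mul_gcd {e n : ℕ} (he : 0 < e) : pull e n * Nat.gcd e n = n := by
  apply Nat.eq_of_mul_eq_mul_left he
  rw [← mul_assoc, mul_pull, mul_comm, Nat.gcd_mul_lcm]

lemma pull_dvd {e n : ℕ} (he : 0 < e) : pull e n ∣ n := ⟨_, (pull_mul_gcd he).symm⟩

lemma le_mul_pull {e n : ℕ} (he : 0 < e) (hn : 0 < n) : n ≤ e * pull e n := by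
  rw [mul_pull]
  exact Nat.le_of_dvd (Nat.lcm_pos he hn) (Nat.dvd_lcm_right e n)

lemma pull_one {e : ℕ} (he : 0 < e) : pull e 1 = 1 := Nat.dvd_one.1 (pull_dvd he)

lemma dvd_of_pull_eq_one {e n : ℕ} (h : pull e n = 1) : n ∣ e := by
  have := mul_pull e n
  rw [h, mul_one] at this
  rw [this]
  exact Nat.dvd_lcm_right e n

lemma pull_lcm {e : ℕ} (he : 0 < e) (m n : ℕ) :
    pull e (Nat.lcm m n) = Nat.lcm (pull e m) (pull e n) := by
  apply Nat.eq_of_mul_eq_mul_left he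
  rw [mul_pull, ← Nat.lcm_mul_left, mul_pull, mul_pull]
  apply Nat.dvd_antisymm
  · refine Nat.lcm_dvd ((Nat.dvd_lcm_left e m).trans (Nat.dvd_lcm_left _ _)) (Nat.lcm_dvd ?_ ?_)
    · exact (Nat.dvd_lcm_right e m).trans (Nat.dvd_lcm_left _ _)
    · exact (Nat.dvd_lcm_right e n).trans (Nat.dvd_lcm_right _ _)
  · exact Nat.lcm_dvd
      (Nat.lcm_dvd (Nat.dvd_lcm_left _ _) ((Nat.dvd_lcm_left m n).trans (Nat.dvd_lcm_right _ _)))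
      (Nat.lcm_dvd (Nat.dvd_lcm_left _ _) ((Nat.dvd_lcm_right m n).trans (Nat.dvd_lcm_right _ _)))

lemma pull_finset_lcm {ι : Type*} {e : ℕ} (he : 0 < e) (s : Finset ι) (f : ι → ℕ) :
    pull e (s.lcm f) = s.lcm fun i => pull e (f i) := by
  classical
  induction s using Finset.induction_on with
  | empty => simpa using pull_one he
  | insert a s _ ih =>
    rw [Finset.lcm_insert, Finset.lcm_insert, ← ih]
    exact pull_lcm he _ _

lemma pull_pull {e e' : ℕ} (he : 0 < e) (he' : 0 < e') (n : ℕ) :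
    pull e (pull e' n) = pull (e * e') n := by
  apply Nat.eq_of_mul_eq_mul_left (Nat.mul_pos he he')
  rw [mul_pull, mul_comm e e', mul_assoc, mul_pull, ← Nat.lcm_mul_left, mul_pull, ← Nat.lcm_assoc]
  congr 1
  exact Nat.lcm_eq_left (Dvd.intro _ rfl)

lemma eq_mul_gcd_iff_eq_pull {e m n : ℕ} (he : 0 < e) : n = m * Nat.gcd e n ↔ m = pull e n := by
  have h := pull_mul_gcd (e := e) (n := n) he
  constructor
  · intro h'
    exact Nat.eq_of_mul_eq_mul_right (Nat.gcd_pos_of_pos_left n he) (h'.symm.trans h.symm)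
  · rintro rfl
    exact h.symm

/-- The pullback of a ramification function along a rational function `A`: the unique function
making `A` a minimal holomorphic map onto the given ramification data. -/
def pullback (A : RatFunc ℂ) (g : Sphere → ℕ) : Sphere → ℕ :=
  fun z => pull (localDegree A z) (g (toMap A z))

lemma isMinimalHolomorphicMap_iff {A : RatFunc ℂ} (hA : 1 ≤ degree A) (O₁ O₂ : Orbifold) :
    IsMinimalHolomorphicMap A O₁ O₂ ↔ O₁.ν = pullback A O₂.ν := by
  rw [IsMinimalHolomorphicMap, funext_iff]
  exact forall_congr' fun z => eq_mul_gcd_iff_eq_pull (localDegree_pos hA z)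

lemma pullback_comp {A B : RatFunc ℂ} (hA : 1 ≤ degree A) (hB : 1 ≤ degree B)
    (g : Sphere → ℕ) : pullback (comp A B) g = pullback B (pullback A g) := by
  funext z
  rw [pullback, pullback, pullback, toMap_comp hA hB, localDegree_comp hA hB,
    pull_pull (localDegree_pos hB z) (localDegree_pos hA _)]

lemma iterate_succ (A : RatFunc ℂ) (l : ℕ) : iterate A (l + 1) = comp A (iterate A l) :=
  Function.iterate_succ_apply' _ _ _

lemma iterate_one (A : RatFunc ℂ) : iterate A 1 = A := comp_X_right A

lemma degree_X : degree RatFunc.X = 1 := by simp [degree]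

lemma degree_iterate_pos {A : RatFunc ℂ} (hA : 1 ≤ degree A) (l : ℕ) :
    1 ≤ degree (iterate A l) := by
  induction l with
  | zero => exact degree_X.ge
  | succ l ih => rw [iterate_succ]; exact degree_comp_pos hA ih

lemma pullback_iterate {A : RatFunc ℂ} (hA : 1 ≤ degree A) {l : ℕ} (hl : 1 ≤ l)
    (g : Sphere → ℕ) : pullback (iterate A l) g = (pullback A)^[l] g := by
  induction l, hl using Nat.le_induction generalizing g with
  | base => rw [iterate_one]; rfl
  | succ l _ ih =>
    rw [iterate_succ, pullback_comp hA (degree_iterate_pos hA l), ih, Function.iterate_succ_apply]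

lemma iterate_pullback_dvd {A : RatFunc ℂ} (hA : 1 ≤ degree A) (g : Sphere → ℕ) (i : ℕ)
    (z : Sphere) : (pullback A)^[i] g z ∣ g ((toMap A)^[i] z) := by
  induction i generalizing z with
  | zero => exact dvd_rfl
  | succ i ih =>
    rw [Function.iterate_succ_apply', Function.iterate_succ_apply]
    exact (pull_dvd (localDegree_pos hA z)).trans (ih _)

/-! ### Least common multiples of orbifolds -/

/-- The union of two orbifold structures: the pointwise least common multiple. -/
def Orbifold.lcm (O₁ O₂ : Orbifold) : Orbifold :=
  have hne : ∀ z, Nat.lcm (O₁.ν z) (O₂.ν z) ≠ 1 ↔ O₁.ν z ≠ 1 ∨ O₂.ν z ≠ 1 := by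
    intro z
    rw [ne_eq, Nat.lcm_eq_one_iff]
    tauto
  have hset : {z | Nat.lcm (O₁.ν z) (O₂.ν z) ≠ 1} = {z | O₁.ν z ≠ 1} ∪ {z | O₂.ν z ≠ 1} := by
    ext z
    exact hne z
  have htwo : ∀ O : Orbifold, ∀ z₁ z₂, {z | O.ν z ≠ 1} ⊆ {z₁, z₂} → O.ν z₁ = O.ν z₂ := by
    intro O z₁ z₂ h
    rcases Set.subset_pair_iff_eq.1 h with h | h | h | h
    · have h1 : ∀ z, O.ν z = 1 := fun z => by
        by_contra hz
        exact (Set.mem_empty_iff_false z).1 (h ▸ hz)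
      rw [h1, h1]
    · exact absurd h (O.not_one_point z₁)
    · exact absurd h (O.not_one_point z₂)
    · exact O.two_points _ _ h
  { ν := fun z => Nat.lcm (O₁.ν z) (O₂.ν z)
    pos := fun z => Nat.lcm_pos (O₁.pos z) (O₂.pos z)
    finite_singular := by
      rw [hset]
      exact O₁.finite_singular.union O₂.finite_singular
    not_one_point := by
      intro z h
      rw [hset] at h
      have h1 : ∀ O : Orbifold, {x | O.ν x ≠ 1} ⊆ {z} → {x | O.ν x ≠ 1} = ∅ := fun O hO =>
        (Set.subset_singleton_iff_eq.1 hO).resolve_right (O.not_one_point z)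
      rw [h1 O₁ (h ▸ Set.subset_union_left), h1 O₂ (h ▸ Set.subset_union_right)] at h
      simp at h
    two_points := by
      intro z₁ z₂ h
      rw [hset] at h
      rw [htwo O₁ z₁ z₂ (h ▸ Set.subset_union_left), htwo O₂ z₁ z₂ (h ▸ Set.subset_union_right)] }

@[simp]
lemma Orbifold.lcm_ν (O₁ O₂ : Orbifold) (z : Sphere) :
    (O₁.lcm O₂).ν z = Nat.lcm (O₁.ν z) (O₂.ν z) := rfl

lemma isMinimalHolomorphicMap_lcm {A : RatFunc ℂ} (hA : 1 ≤ degree A) {O₁ O₂ : Orbifold}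
    (h₁ : IsMinimalHolomorphicMap A O₁ O₁) (h₂ : IsMinimalHolomorphicMap A O₂ O₂) :
    IsMinimalHolomorphicMap A (O₁.lcm O₂) (O₁.lcm O₂) := by
  rw [isMinimalHolomorphicMap_iff hA] at *
  funext z
  rw [pullback, Orbifold.lcm_ν, Orbifold.lcm_ν, pull_lcm (localDegree_pos hA z)]
  conv_lhs => rw [h₁, h₂]
  rfl

/-! ### Orbifolds invariant under an iterate -/

lemma isMinimalHolomorphicMap_iterate {A : RatFunc ℂ} (hA : 1 ≤ degree A) {O : Orbifold}
    (h : IsMinimalHolomorphicMap A O O) {l : ℕ} (hl : 1 ≤ l) :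
    IsMinimalHolomorphicMap (iterate A l) O O := by
  rw [isMinimalHolomorphicMap_iff (degree_iterate_pos hA l), pullback_iterate hA hl]
  rw [isMinimalHolomorphicMap_iff hA] at h
  exact (Function.iterate_fixed h.symm l).symm

/-- An orbifold invariant under an iterate of `A` is dominated by one invariant under `A`, namely
by the least common multiple of its successive pullbacks along `A`. -/
lemma exists_precedes_of_iterate {A : RatFunc ℂ} (hA : 1 ≤ degree A) {O : Orbifold} {l : ℕ}
    (hl : 1 ≤ l) (h : IsMinimalHolomorphicMap (iterate A l) O O) :
    ∃ M : Orbifold, IsMinimalHolomorphicMap A M M ∧ O.Precedes M := by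
  rw [isMinimalHolomorphicMap_iff (degree_iterate_pos hA l), pullback_iterate hA hl] at h
  set g : ℕ → Sphere → ℕ := fun i => (pullback A)^[i] O.ν with hg
  have hgl : g l = g 0 := h.symm
  have hdvd : ∀ i z, g i z ∣ O.ν ((toMap A)^[i] z) := fun i z => iterate_pullback_dvd hA O.ν i z
  set M : Sphere → ℕ := fun z => (Finset.range l).lcm fun i => g i z with hM
  have hMpull : M = pullback A M := by
    funext z
    rw [pullback, hM]
    simp only
    rw [pull_finset_lcm (localDegree_pos hA z)]
    have hstep : ∀ i, pull (localDegree A z) (g i (toMap A z)) = g (i + 1) z := fun i => by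
      rw [hg]
      simp only [Function.iterate_succ_apply']
      rfl
    simp only [hstep]
    obtain ⟨k, rfl⟩ : ∃ k, l = k + 1 := ⟨l - 1, by omega⟩
    -- Both families are cyclic permutations of each other, as `g (k + 1) = g 0`.
    apply Nat.dvd_antisymm
    · refine Finset.lcm_dvd fun i hi => ?_
      rcases i with _ | i
      · rw [← hgl]
        exact Finset.dvd_lcm (f := fun i => g (i + 1) z) (b := k) (by simp)
      · exact Finset.dvd_lcm (f := fun i => g (i + 1) z) (b := i) (by simp at hi ⊢; omega)
    · refine Finset.lcm_dvd fun i hi => ?_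
      rcases Nat.lt_or_ge i k with hik | hik
      · exact Finset.dvd_lcm (f := fun i => g i z) (b := i + 1) (by simp; omega)
      · obtain rfl : i = k := by simp at hi; omega
        rw [hgl]
        exact Finset.dvd_lcm (f := fun i => g i z) (b := 0) (by simp)
  have hνM : ∀ z, O.ν z ∣ M z := fun z =>
    Finset.dvd_lcm (f := fun i => g i z) (b := 0) (by simp; omega)
  have hpos : ∀ z, 0 < M z := by
    intro z
    rw [Nat.pos_iff_ne_zero, hM]
    simp only [ne_eq, Finset.lcm_eq_zero_iff]
    rintro ⟨i, -, hi⟩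
    have := hdvd i z
    rw [hi, zero_dvd_iff] at this
    exact (O.pos _).ne' this
  have hone : (∀ z, O.ν z = 1) → ∀ z, M z = 1 := by
    intro h1 z
    refine Nat.dvd_one.1 (Finset.lcm_dvd fun i _ => ?_)
    rw [← h1 ((toMap A)^[i] z)]
    exact hdvd i z
  have hsub : {z | O.ν z ≠ 1} ⊆ {z | M z ≠ 1} := by
    intro z hz h1
    exact hz (Nat.dvd_one.1 (h1 ▸ hνM z))
  have hfwd : ∀ i z, M z ≠ 1 → M ((toMap A)^[i] z) ≠ 1 := by
    intro i
    induction i with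
    | zero => exact fun z hz => hz
    | succ i ih =>
      intro z hz
      rw [Function.iterate_succ_apply]
      refine ih _ fun h1 => hz ?_
      rw [hMpull, pullback, h1, pull_one (localDegree_pos hA z)]
  have hempty : {z | O.ν z ≠ 1} = ∅ → {z | M z ≠ 1} = ∅ := by
    intro h0
    rw [Set.eq_empty_iff_forall_notMem] at h0 ⊢
    exact fun z hz => hz (hone (fun z => not_not.1 (h0 z)) z)
  refine ⟨⟨M, hpos, ?_, ?_, ?_⟩, (isMinimalHolomorphicMap_iff hA _ _).2 hMpull, hνM⟩
  · have hpre : ∀ i, {z | O.ν ((toMap A)^[i] z) ≠ 1}.Finite := by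
      intro i
      induction i with
      | zero => exact O.finite_singular
      | succ i ih =>
        have h0 : {z | O.ν ((toMap A)^[i + 1] z) ≠ 1} =
            ((preimage A hA ih.toFinset : Finset Sphere) : Set Sphere) := by
          ext z
          simp
        rw [h0]
        exact Finset.finite_toSet _
    refine (Set.Finite.biUnion (Finset.range l).finite_toSet fun i _ => hpre i).subset ?_
    intro z hz
    by_contra hcon
    refine hz (Nat.dvd_one.1 (Finset.lcm_dvd fun i hi => ?_))
    have h1 : O.ν ((toMap A)^[i] z) = 1 := by
      by_contra hne
      exact hcon (Set.mem_biUnion (x := i) (by simpa using hi) hne)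
    rw [← h1]
    exact hdvd i z
  · intro z₁ h1
    rw [h1] at hsub
    have h0 := hempty ((Set.subset_singleton_iff_eq.1 hsub).resolve_right (O.not_one_point z₁))
    rw [h0] at h1
    exact Set.singleton_ne_empty _ h1.symm
  · intro z₁ z₂ h2
    rw [h2] at hsub
    rcases Set.subset_pair_iff_eq.1 hsub with h0 | h0 | h0 | h0
    · rw [hempty h0] at h2
      exact absurd h2.symm ((Set.insert_nonempty _ _).ne_empty)
    · exact absurd h0 (O.not_one_point z₁)
    · exact absurd h0 (O.not_one_point z₂)
    · have heq := O.two_points _ _ h0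
      -- Forward orbits of the two points stay inside the pair, where `O.ν` is constant.
      have hMz : ∀ z, M z ≠ 1 → O.ν z = O.ν z₁ := by
        intro z hz
        have : z ∈ ({z₁, z₂} : Set Sphere) := h2 ▸ hz
        rcases this with rfl | rfl
        · rfl
        · exact heq.symm
      have hval : ∀ z, M z ≠ 1 → M z = O.ν z₁ := by
        intro z hz
        apply Nat.dvd_antisymm
        · refine Finset.lcm_dvd fun i _ => ?_
          rw [← hMz _ (hfwd i z hz)]
          exact hdvd i z
        · rw [← hMz z hz]
          exact hνM z
      have hz1 : z₁ ∈ {z | M z ≠ 1} := by rw [h2]; simp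
      have hz2 : z₂ ∈ {z | M z ≠ 1} := by rw [h2]; simp
      exact (hval z₁ hz1).trans (hval z₂ hz2).symm

/-! ### Invariant orbifolds with large ramification -/

/-- A finite set containing its own preimage has at most two points and is permuted by the rational
function: the total ramification over it is at least `d - 1` times its cardinality. -/
lemma card_le_two_of_preimage_subset {A : RatFunc ℂ} (hA : 2 ≤ degree A) (hA1 : 1 ≤ degree A)
    {E : Finset Sphere} (hE : preimage A hA1 E ⊆ E) :
    E.card ≤ 2 ∧ Set.BijOn (toMap A) E E := by
  classical
  have hsum : ∑ z ∈ preimage A hA1 E, localDegree A z =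
      ∑ z ∈ preimage A hA1 E, (localDegree A z - 1) + (preimage A hA1 E).card := by
    rw [Finset.card_eq_sum_ones, ← Finset.sum_add_distrib]
    exact Finset.sum_congr rfl fun z _ => (Nat.sub_add_cancel (localDegree_pos hA1 z)).symm
  rw [sum_localDegree_preimage] at hsum
  have hRH := sum_localDegree_sub_one_le hA1 (preimage A hA1 E)
  have hcard := Finset.card_le_card hE
  have himage : (preimage A hA1 E).image (toMap A) = E := by
    ext w
    simp only [Finset.mem_image, mem_preimage]
    constructor
    · rintro ⟨z, hz, rfl⟩; exact hz
    · intro hw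
      obtain ⟨z, rfl⟩ := toMap_surjective hA1 w
      exact ⟨z, hw, rfl⟩
  have hcard' : E.card ≤ (preimage A hA1 E).card := by
    conv_lhs => rw [← himage]
    exact Finset.card_image_le
  have heq : preimage A hA1 E = E := Finset.eq_of_subset_of_card_le hE hcard'
  refine ⟨?_, ?_, ?_, ?_⟩
  · by_contra! h3
    obtain ⟨d, hd⟩ : ∃ d, degree A = d + 2 := ⟨degree A - 2, by omega⟩
    rw [hd] at hsum hRH
    have : 3 * (d + 1) ≤ E.card * (d + 1) := Nat.mul_le_mul_right _ h3
    have hexp : E.card * (d + 2) = E.card * (d + 1) + E.card := by ring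
    omega
  · intro z hz
    rw [← heq] at hz
    simpa using hz
  · rw [← Finset.card_image_iff]
    conv_lhs => rw [← heq, himage]
  · intro w hw
    rw [Finset.mem_coe, ← himage, heq] at hw
    simpa using hw

section Invariant

variable {A : RatFunc ℂ} {O : Orbifold}

/-- The singular points of an orbifold, as a finite set. -/
def Orbifold.support (O : Orbifold) : Finset Sphere := O.finite_singular.toFinset

@[simp]
lemma Orbifold.mem_support (O : Orbifold) (z : Sphere) : z ∈ O.support ↔ O.ν z ≠ 1 := by
  simp [Orbifold.support]

lemma toMap_mem_support (hA1 : 1 ≤ degree A) (hO : IsMinimalHolomorphicMap A O O) {z : Sphere}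
    (hz : z ∈ O.support) : toMap A z ∈ O.support := by
  rw [isMinimalHolomorphicMap_iff hA1] at hO
  rw [O.mem_support] at hz ⊢
  intro h1
  apply hz
  rw [hO, pullback, h1, pull_one (localDegree_pos hA1 z)]

open Classical in
/-- A preimage of a singular point is either singular or of local degree at least two. Summed over
all such preimages, this bounds the degree by the total ramification. -/
lemma localDegree_le_two_mul_sub_one (hA1 : 1 ≤ degree A) (hO : IsMinimalHolomorphicMap A O O)
    {z : Sphere} (hz : toMap A z ∈ O.support) :
    localDegree A z ≤ 2 * (localDegree A z - 1) + if z ∈ O.support then 1 else 0 := by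
  have he := localDegree_pos hA1 z
  split_ifs with hS
  · omega
  · rw [isMinimalHolomorphicMap_iff hA1] at hO
    rw [O.mem_support, not_not] at hS
    rw [O.mem_support] at hz
    rw [hO] at hS
    have hdvd := dvd_of_pull_eq_one hS
    have h1 : localDegree A z ≠ 1 := fun h1 => hz (Nat.dvd_one.1 (h1 ▸ hdvd))
    omega

lemma card_support_le_four (hA : 2 ≤ degree A) (hA1 : 1 ≤ degree A)
    (hO : IsMinimalHolomorphicMap A O O) : O.support.card ≤ 4 := by
  classical
  set S := O.support with hS
  have h1 : ∑ z ∈ preimage A hA1 S, localDegree A z ≤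
      ∑ z ∈ preimage A hA1 S, (2 * (localDegree A z - 1) + if z ∈ S then 1 else 0) :=
    Finset.sum_le_sum fun z hz =>
      localDegree_le_two_mul_sub_one hA1 hO ((mem_preimage hA1 S z).1 hz)
  rw [sum_localDegree_preimage, Finset.sum_add_distrib, ← Finset.mul_sum,
    Finset.sum_boole] at h1
  have hRH := sum_localDegree_sub_one_le hA1 (preimage A hA1 S)
  have h2 : ((preimage A hA1 S).filter (· ∈ S)).card ≤ S.card :=
    Finset.card_le_card fun z hz => (Finset.mem_filter.1 hz).2
  simp only [Nat.cast_id] at h1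
  obtain ⟨d, hd⟩ : ∃ d, degree A = d + 2 := ⟨degree A - 2, by omega⟩
  rw [hd] at h1 hRH
  have hexp : S.card * (d + 2) = S.card * (d + 1) + S.card := by ring
  by_contra! h5
  have : 5 * (d + 1) ≤ S.card * (d + 1) := Nat.mul_le_mul_right _ h5
  omega

/-- The points where the ramification exceeds a given power of the degree pull back into the points
where it exceeds the preceding power. -/
lemma lt_ν_of_lt_ν_toMap (hA1 : 1 ≤ degree A) (hO : IsMinimalHolomorphicMap A O O) {j : ℕ}
    {z : Sphere} (h : degree A ^ (j + 1) < O.ν (toMap A z)) : degree A ^ j < O.ν z := by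
  rw [isMinimalHolomorphicMap_iff hA1] at hO
  have h1 : O.ν (toMap A z) ≤ localDegree A z * O.ν z := by
    conv_rhs => rw [hO]
    exact le_mul_pull (localDegree_pos hA1 z) (O.pos _)
  have h2 : localDegree A z * O.ν z ≤ degree A * O.ν z :=
    Nat.mul_le_mul_right _ (localDegree_le hA1 z)
  rw [pow_succ, mul_comm] at h
  exact Nat.lt_of_mul_lt_mul_left (h.trans_le (h1.trans h2))

lemma exists_completely_invariant (hA : 2 ≤ degree A) (hA1 : 1 ≤ degree A)
    (hO : IsMinimalHolomorphicMap A O O) {z₀ : Sphere} (hz₀ : degree A ^ 4 < O.ν z₀) :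
    ∃ n : ℕ, 1 ≤ n ∧ ∃ E : Finset Sphere, E.Nonempty ∧ preimage A hA1 E ⊆ E ∧
      ∀ z, z ∈ E ↔ n < O.ν z := by
  classical
  set L : ℕ → Finset Sphere := fun j => O.support.filter fun z => degree A ^ j < O.ν z with hL
  have hmem : ∀ j z, z ∈ L j ↔ degree A ^ j < O.ν z := by
    intro j z
    simp only [hL, Finset.mem_filter, O.mem_support, and_iff_right_iff_imp]
    have := Nat.one_le_pow j _ hA1
    omega
  have hanti : ∀ j, L (j + 1) ⊆ L j := by
    intro j z hz
    rw [hmem] at hz ⊢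
    exact (Nat.pow_le_pow_right hA1 (Nat.le_succ j)).trans_lt hz
  have hpre : ∀ j z, toMap A z ∈ L (j + 1) → z ∈ L j := by
    intro j z hz
    rw [hmem] at hz ⊢
    exact lt_ν_of_lt_ν_toMap hA1 hO hz
  have hL0 : (L 0).card ≤ 4 :=
    (Finset.card_le_card (Finset.filter_subset _ _)).trans (card_support_le_four hA hA1 hO)
  have hL4 : 0 < (L 4).card := Finset.card_pos.2 ⟨z₀, (hmem 4 z₀).2 hz₀⟩
  -- Five nested nonempty sets with at most four points cannot all be distinct.
  obtain ⟨j, hj, heq⟩ : ∃ j, (L 4).card ≤ (L j).card ∧ L (j + 1) = L j := by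
    by_contra! hne
    have hlt : ∀ j, (L 4).card ≤ (L j).card → (L (j + 1)).card < (L j).card := fun j hj =>
      Finset.card_lt_card (Finset.ssubset_iff_subset_ne.2 ⟨hanti j, hne j hj⟩)
    have h3 := Finset.card_le_card (hanti 3)
    have h2 := Finset.card_le_card (hanti 2)
    have h1 := Finset.card_le_card (hanti 1)
    have h0 := Finset.card_le_card (hanti 0)
    simp only [Nat.reduceAdd, zero_add] at h0 h1 h2 h3
    have k3 := hlt 3 h3
    have k2 := hlt 2 (h3.trans h2)
    have k1 := hlt 1 (h3.trans (h2.trans h1))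
    have k0 := hlt 0 (h3.trans (h2.trans (h1.trans h0)))
    simp only [Nat.reduceAdd, zero_add] at k0 k1 k2 k3
    omega
  refine ⟨degree A ^ j, Nat.one_le_pow j _ hA1, L j, Finset.card_pos.1 (hL4.trans_le hj), ?_,
    hmem j⟩
  intro z hz
  rw [mem_preimage, ← heq] at hz
  exact hpre j z hz

/-- The ramification pattern of a Chebyshev polynomial: a totally ramified fixed point `w`, and a
forward invariant pair `a`, `b` whose points are unramified, while all their other preimages have
local degree two. -/
structure IsChebyshevLike (A : RatFunc ℂ) (w a b : Sphere) : Prop where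
  ne_left : a ≠ w
  ne_right : b ≠ w
  ne : a ≠ b
  toMap_eq_iff : ∀ z, toMap A z = w ↔ z = w
  toMap_left : toMap A a = a ∨ toMap A a = b
  toMap_right : toMap A b = a ∨ toMap A b = b
  localDegree_left : localDegree A a = 1
  localDegree_right : localDegree A b = 1
  localDegree_eq_two : ∀ z, toMap A z = a ∨ toMap A z = b → z ≠ a → z ≠ b → localDegree A z = 2

/-- If the points of ramification greater than `n` of an invariant orbifold reduce to a single
completely invariant point, the rational function has the ramification of a Chebyshev
polynomial. -/
lemma exists_isChebyshevLike (hA : 2 ≤ degree A) (hA1 : 1 ≤ degree A)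
    (hO : IsMinimalHolomorphicMap A O O) {n : ℕ} (hn : 1 ≤ n) {w : Sphere}
    (hw : ∀ z, z = w ↔ n < O.ν z) (hfib : ∀ z, toMap A z = w ↔ z = w) :
    ∃ a b, IsChebyshevLike A w a b := by
  classical
  set S := O.support with hS
  set S' := S.erase w with hS'
  have hwS : w ∈ S := by
    rw [hS, O.mem_support]
    have := (hw w).1 rfl
    omega
  have hwT : w ∉ preimage A hA1 S' := by
    rw [mem_preimage, (hfib w).2 rfl]
    exact Finset.notMem_erase w S
  have hew : localDegree A w = degree A := localDegree_eq_degree_of_fiber hA1 hfib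
  have hRH := sum_localDegree_sub_one_le hA1 (insert w (preimage A hA1 S'))
  rw [Finset.sum_insert hwT, hew] at hRH
  have hle : ∀ z ∈ preimage A hA1 S', localDegree A z ≤
      2 * (localDegree A z - 1) + if z ∈ S' then 1 else 0 := by
    intro z hz
    have hzw : z ≠ w := fun h => hwT (h ▸ hz)
    have h := localDegree_le_two_mul_sub_one hA1 hO (z := z)
      (Finset.mem_of_mem_erase ((mem_preimage hA1 S' z).1 hz))
    have hiff : z ∈ S' ↔ z ∈ S := by rw [hS', Finset.mem_erase, and_iff_right hzw]
    rw [if_congr hiff rfl rfl]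
    exact h
  have hsum : ∑ z ∈ preimage A hA1 S', (2 * (localDegree A z - 1) + if z ∈ S' then 1 else 0) =
      2 * ∑ z ∈ preimage A hA1 S', (localDegree A z - 1) + S'.card := by
    rw [Finset.sum_add_distrib, ← Finset.mul_sum, Finset.sum_boole, Nat.cast_id]
    congr 2
    ext z
    rw [Finset.mem_filter, and_iff_right_iff_imp, mem_preimage]
    intro hz
    have hzw : z ≠ w := Finset.ne_of_mem_erase hz
    refine Finset.mem_erase.2 ⟨fun h => hzw ((hfib z).1 h), ?_⟩
    exact toMap_mem_support hA1 hO (Finset.mem_of_mem_erase hz)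
  have h1 := Finset.sum_le_sum hle
  rw [hsum, sum_localDegree_preimage] at h1
  obtain ⟨d, hd⟩ : ∃ d, degree A = d + 2 := ⟨degree A - 2, by omega⟩
  have hexp : S'.card * degree A = S'.card * (d + 1) + S'.card := by rw [hd]; ring
  have hk2 : S'.card ≤ 2 := by
    by_contra! h3
    have : 3 * (d + 1) ≤ S'.card * (d + 1) := Nat.mul_le_mul_right _ h3
    omega
  have hins : insert w S' = S := Finset.insert_erase hwS
  have hk : S'.card = 2 := by
    rcases Nat.lt_or_ge S'.card 2 with hlt | hge
    · exfalso
      have hset : {z | O.ν z ≠ 1} = ((insert w S' : Finset Sphere) : Set Sphere) := by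
        rw [hins, hS]
        ext z
        simp
      rcases Nat.lt_or_ge S'.card 1 with h0 | h0
      · have : S' = ∅ := Finset.card_eq_zero.1 (by omega)
        rw [this] at hset
        exact O.not_one_point w (by simpa using hset)
      · obtain ⟨s, hs⟩ := Finset.card_eq_one.1 (show S'.card = 1 by omega)
        have hsw : s ≠ w := Finset.ne_of_mem_erase (s := S) (by rw [← hS', hs]; simp)
        rw [hs] at hset
        have h2 := O.two_points w s (by simpa using hset)
        apply hsw
        rw [hw, ← h2]
        exact (hw w).1 rfl
    · omega
  have heq : ∀ z ∈ preimage A hA1 S', localDegree A z =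
      2 * (localDegree A z - 1) + if z ∈ S' then 1 else 0 := by
    refine (Finset.sum_eq_sum_iff_of_le hle).1 (le_antisymm (Finset.sum_le_sum hle) ?_)
    rw [hsum, sum_localDegree_preimage, hk]
    omega
  obtain ⟨a, b, hab, hab'⟩ := Finset.card_eq_two.1 hk
  have hmem : ∀ z, z ∈ S' ↔ z = a ∨ z = b := by intro z; rw [hab']; simp
  have ha : a ∈ S' := (hmem a).2 (Or.inl rfl)
  have hb : b ∈ S' := (hmem b).2 (Or.inr rfl)
  have hmap : ∀ z ∈ S', toMap A z ∈ S' := by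
    intro z hz
    refine Finset.mem_erase.2 ⟨fun h => Finset.ne_of_mem_erase hz ((hfib z).1 h), ?_⟩
    exact toMap_mem_support hA1 hO (Finset.mem_of_mem_erase hz)
  have hdeg : ∀ z ∈ S', localDegree A z = 1 := by
    intro z hz
    have h := heq z ((mem_preimage hA1 S' z).2 (hmap z hz))
    have := localDegree_pos hA1 z
    rw [if_pos hz] at h
    omega
  refine ⟨a, b, Finset.ne_of_mem_erase ha, Finset.ne_of_mem_erase hb, hab, hfib,
    (hmem _).1 (hmap a ha), (hmem _).1 (hmap b hb), hdeg a ha, hdeg b hb, ?_⟩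
  intro z hz hza hzb
  have h := heq z ((mem_preimage hA1 S' z).2 ((hmem _).2 hz))
  have := localDegree_pos hA1 z
  rw [if_neg fun hm => ((hmem z).1 hm).elim hza hzb] at h
  omega

/-- An invariant orbifold with ramification greater than `(deg A) ^ 4` forces `A` to have the
ramification of `z ^ d`, of `z ^ (-d)`, or of a Chebyshev polynomial. -/
lemma exceptional_of_large_ramification (hA : 2 ≤ degree A) (hA1 : 1 ≤ degree A)
    (hO : IsMinimalHolomorphicMap A O O) {z₀ : Sphere} (hz₀ : degree A ^ 4 < O.ν z₀) :
    (∃ p q, p ≠ q ∧ (∀ z, toMap A z = p ↔ z = p) ∧ ∀ z, toMap A z = q ↔ z = q) ∨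
    (∃ p q, p ≠ q ∧ (∀ z, toMap A z = p ↔ z = q) ∧ ∀ z, toMap A z = q ↔ z = p) ∨
    ∃ w a b, IsChebyshevLike A w a b := by
  classical
  obtain ⟨n, hn, E, hE, hEA, hEν⟩ := exists_completely_invariant hA hA1 hO hz₀
  obtain ⟨hcard, hmaps, hinj, -⟩ := card_le_two_of_preimage_subset hA hA1 hEA
  have hback : ∀ z, toMap A z ∈ E → z ∈ E := fun z hz => hEA ((mem_preimage hA1 E z).2 hz)
  have hone : ∀ x y, x ∈ E → toMap A x = y → ∀ z, toMap A z = y ↔ z = x := by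
    intro x y hx hxy z
    constructor
    · intro hz
      have hy : y ∈ E := hxy ▸ hmaps hx
      exact hinj (hback z (hz.symm ▸ hy)) hx (hz.trans hxy.symm)
    · rintro rfl
      exact hxy
  have hpos := Finset.card_pos.2 hE
  obtain h1 | h2 : E.card = 1 ∨ E.card = 2 := by omega
  · right; right
    obtain ⟨w, rfl⟩ := Finset.card_eq_one.1 h1
    have hww : toMap A w = w := by
      have := hmaps (Finset.mem_coe.2 (Finset.mem_singleton_self w))
      simpa using this
    refine ⟨w, exists_isChebyshevLike hA hA1 hO hn (fun z => ?_) (hone w w (by simp) hww)⟩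
    rw [← hEν]
    simp
  · obtain ⟨p, q, hpq, rfl⟩ := Finset.card_eq_two.1 h2
    have hp : toMap A p = p ∨ toMap A p = q := by
      simpa using hmaps (show p ∈ ((({p, q} : Finset Sphere)) : Set Sphere) by simp)
    have hq : toMap A q = p ∨ toMap A q = q := by
      simpa using hmaps (show q ∈ ((({p, q} : Finset Sphere)) : Set Sphere) by simp)
    have hne : toMap A p ≠ toMap A q := fun h => hpq (hinj (by simp) (by simp) h)
    rcases hp with hp | hp
    · have hq' : toMap A q = q := hq.resolve_left fun h => hne (hp.trans h.symm)
      exact Or.inl ⟨p, q, hpq, hone p p (by simp) hp, hone q q (by simp) hq'⟩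
    · have hq' : toMap A q = p := hq.resolve_right fun h => hne (hp.trans h.symm)
      exact Or.inr (Or.inl ⟨p, q, hpq, hone q p (by simp) hq', hone p q (by simp) hp⟩)

end Invariant

/-! ### Möbius transformations -/

lemma localDegree_of_degree_eq_one {μ : RatFunc ℂ} (hμ : degree μ = 1) (z : Sphere) :
    localDegree μ z = 1 :=
  le_antisymm ((localDegree_le hμ.ge z).trans hμ.le) (localDegree_pos hμ.ge z)

lemma toMap_bijective_of_degree_eq_one {μ : RatFunc ℂ} (hμ : degree μ = 1) :
    Function.Bijective (toMap μ) := by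
  refine ⟨fun x y hxy => ?_, toMap_surjective hμ.ge⟩
  have h := sum_localDegree_fiber hμ.ge (toMap μ y)
  rw [Finset.sum_congr rfl fun z _ => localDegree_of_degree_eq_one hμ z, Finset.sum_const,
    smul_eq_mul, mul_one] at h
  exact Finset.card_le_one.1 (h.trans hμ).le x (by simpa using hxy) y (by simp)

/-- A function whose only pole is a simple one has degree one. -/
lemma degree_eq_one_of_ord {μ : RatFunc ℂ} {p : Sphere} (hp : ord p μ = -1)
    (h : ∀ z, z ≠ p → 0 ≤ ord z μ) : degree μ = 1 := by
  have hμ : 1 ≤ degree μ := by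
    refine degree_pos_of_ne_C fun a ha => ?_
    rw [ha, ord_C] at hp
    omega
  have hfib : ∀ z, toMap μ z = OnePoint.infty ↔ z = p := by
    intro z
    rw [toMap_eq_infty_iff_ord hμ]
    constructor
    · intro hz
      by_contra hne
      have := h z hne
      omega
    · rintro rfl
      omega
  rw [← localDegree_eq_degree_of_fiber hμ hfib]
  classical
  have h1 := ord_sub_C hμ 0 p
  rw [(hfib p).2 rfl, map_zero, sub_zero, hp, ← map_zero (RatFunc.C (K := ℂ)), ord_X_sub_C] at h1
  simp at h1
  omega

open Classical in
/-- The Möbius transformation with a zero at `q` and a pole at `p`, given through its divisor. -/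
lemma exists_ord_eq {p q : Sphere} (hpq : p ≠ q) :
    ∃ μ : RatFunc ℂ, μ ≠ 0 ∧ ∀ z, ord z μ = if z = q then 1 else if z = p then -1 else 0 := by
  have hX : ∀ a : ℂ, (RatFunc.X - RatFunc.C a : RatFunc ℂ) ≠ 0 := fun a =>
    sub_C_ne_zero degree_X.ge a
  induction p using OnePoint.rec with
  | infty =>
    induction q using OnePoint.rec with
    | infty => exact absurd rfl hpq
    | coe q => exact ⟨RatFunc.X - RatFunc.C q, hX q, fun z => ord_X_sub_C q z⟩
  | coe p =>
    induction q using OnePoint.rec with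
    | infty =>
      refine ⟨(RatFunc.X - RatFunc.C p)⁻¹, inv_ne_zero (hX p), fun z => ?_⟩
      rw [ord_inv, ord_X_sub_C]
      split_ifs <;> simp_all
    | coe q =>
      refine ⟨(RatFunc.X - RatFunc.C q) * (RatFunc.X - RatFunc.C p)⁻¹,
        mul_ne_zero (hX q) (inv_ne_zero (hX p)), fun z => ?_⟩
      rw [ord_mul _ (hX q) (inv_ne_zero (hX p)), ord_inv, ord_X_sub_C, ord_X_sub_C]
      split_ifs <;> simp_all

lemma degree_eq_one_of_ord_eq {μ : RatFunc ℂ} {p q : Sphere}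
    (hq : ord q μ = 1) (hp : ord p μ = -1) (h : ∀ z, z ≠ p → z ≠ q → ord z μ = 0) :
    degree μ = 1 := by
  refine degree_eq_one_of_ord hp fun z hz => ?_
  by_cases hzq : z = q
  · rw [hzq, hq]; norm_num
  · rw [h z hz hzq]

/-! ### Power maps -/

/-- A rational function for which `p` and `q` are each the only preimage of themselves is
conjugate to a power: conjugating `p`, `q` to `∞`, `0`, both sides of the conjugacy have
the same divisor, and a rescaling removes the constant. -/
lemma conjugate_pow {A : RatFunc ℂ} (hA : 2 ≤ degree A) {p q : Sphere} (hpq : p ≠ q)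
    (hp : ∀ z, toMap A z = p ↔ z = p) (hq : ∀ z, toMap A z = q ↔ z = q) :
    Conjugate A (RatFunc.X ^ degree A) := by
  classical
  have hA1 : 1 ≤ degree A := by omega
  obtain ⟨μ, hμ0, hμ⟩ := exists_ord_eq hpq
  have hord : ∀ z, ord z (comp μ A) = ord z (μ ^ degree A) := by
    intro z
    rw [ord_comp hA1 hμ0, ord_pow z hμ0, hμ, hμ]
    simp only [hp, hq]
    split_ifs with h1 h2
    · rw [h1, localDegree_eq_degree_of_fiber hA1 hq]
    · rw [h2, localDegree_eq_degree_of_fiber hA1 hp]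
    · simp
  obtain ⟨c, hc, hcomp⟩ :=
    exists_eq_C_mul_of_ord_eq (comp_ne_zero hμ0 hA1) (pow_ne_zero _ hμ0) hord
  obtain ⟨t, ht⟩ := IsAlgClosed.exists_pow_nat_eq c (n := degree A - 1) (by omega)
  have ht0 : t ≠ 0 := by
    rintro rfl
    rw [zero_pow (by omega)] at ht
    exact hc ht.symm
  have htC : RatFunc.C t ≠ 0 := by simpa using ht0
  have hdeg : degree (RatFunc.C t * μ) = 1 := by
    refine degree_eq_one_of_ord_eq (p := p) (q := q) ?_ ?_ ?_
    · rw [ord_mul _ htC hμ0, ord_C, hμ]; simp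
    · rw [ord_mul _ htC hμ0, ord_C, hμ]; simp [hpq]
    · intro z hzp hzq
      rw [ord_mul _ htC hμ0, ord_C, hμ]; simp [hzp, hzq]
  refine ⟨RatFunc.C t * μ, hdeg, ?_⟩
  rw [← compHom_apply A hA1, ← compHom_apply _ hdeg.ge, map_mul, map_pow, compHom_apply,
    compHom_apply, compHom_apply, comp_C_left, comp_X_left, hcomp, mul_pow, ← ht, ← mul_assoc,
    map_pow, ← pow_succ', Nat.sub_add_cancel hA1]

/-- A rational function for which two points are each the only preimage of the other one is
conjugate to a negative power. -/
lemma conjugate_inv_pow {A : RatFunc ℂ} (hA1 : 1 ≤ degree A) {p q : Sphere} (hpq : p ≠ q)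
    (hp : ∀ z, toMap A z = p ↔ z = q) (hq : ∀ z, toMap A z = q ↔ z = p) :
    Conjugate A (RatFunc.X ^ degree A)⁻¹ := by
  classical
  obtain ⟨μ, hμ0, hμ⟩ := exists_ord_eq hpq
  have hord : ∀ z, ord z (comp μ A) = ord z (μ ^ degree A)⁻¹ := by
    intro z
    rw [ord_comp hA1 hμ0, ord_inv, ord_pow z hμ0, hμ, hμ]
    simp only [hp, hq]
    split_ifs with h1 h2 h3
    · exact absurd (h1.symm.trans h2) hpq
    · rw [h1, localDegree_eq_degree_of_fiber hA1 hq]; ring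
    · rw [h3, localDegree_eq_degree_of_fiber hA1 hp]; ring
    · simp
  obtain ⟨c, hc, hcomp⟩ :=
    exists_eq_C_mul_of_ord_eq (comp_ne_zero hμ0 hA1) (inv_ne_zero (pow_ne_zero _ hμ0)) hord
  obtain ⟨t, ht⟩ := IsAlgClosed.exists_pow_nat_eq c⁻¹ (n := degree A + 1) (by omega)
  have ht0 : t ≠ 0 := by
    rintro rfl
    rw [zero_pow (by omega)] at ht
    exact inv_ne_zero hc ht.symm
  have htC : RatFunc.C t ≠ 0 := by simpa using ht0
  have hdeg : degree (RatFunc.C t * μ) = 1 := by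
    refine degree_eq_one_of_ord_eq (p := p) (q := q) ?_ ?_ ?_
    · rw [ord_mul _ htC hμ0, ord_C, hμ]; simp
    · rw [ord_mul _ htC hμ0, ord_C, hμ]; simp [hpq]
    · intro z hzp hzq
      rw [ord_mul _ htC hμ0, ord_C, hμ]; simp [hzp, hzq]
  refine ⟨RatFunc.C t * μ, hdeg, ?_⟩
  have hc' : c = (t ^ (degree A + 1))⁻¹ := by rw [ht, inv_inv]
  rw [← compHom_apply A hA1, ← compHom_apply _ hdeg.ge, map_mul, map_inv₀, map_pow, compHom_apply,
    compHom_apply, compHom_apply, comp_C_left, comp_X_left, hcomp, hc', map_inv₀, map_pow]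
  field_simp
  ring

/-! ### Chebyshev polynomials -/

lemma coeff_X_mul_derivative (P : ℂ[X]) (m : ℕ) :
    (X * derivative P).coeff m = m * P.coeff m := by
  cases m with
  | zero => simp
  | succ m => rw [coeff_X_mul, coeff_derivative]; push_cast; ring

/-- The Chebyshev differential equation has no nonzero polynomial solution of degree less than
`n`: the leading coefficients would have to agree. -/
lemma eq_zero_of_chebyshev_ode {P : ℂ[X]} {n : ℕ} (hn : P.natDegree < n)
    (h : (X ^ 2 - 1) * derivative (derivative P) + X * derivative P =
      Polynomial.C ((n : ℂ) ^ 2) * P) : P = 0 := by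
  by_contra hP
  have h' : X * derivative (X * derivative P) - derivative (derivative P) =
      Polynomial.C ((n : ℂ) ^ 2) * P := by
    rw [← h, derivative_mul, derivative_X]
    ring
  have hc := congrArg (fun Q => Polynomial.coeff Q P.natDegree) h'
  simp only [coeff_sub, coeff_X_mul_derivative, coeff_derivative, coeff_C_mul] at hc
  rw [coeff_eq_zero_of_natDegree_lt (n := P.natDegree + 1 + 1) (by omega), zero_mul, zero_mul,
    sub_zero, ← mul_assoc, coeff_natDegree] at hc
  have hsq := mul_right_cancel₀ (leadingCoeff_ne_zero.2 hP) hc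
  have hsq' : P.natDegree * P.natDegree = n ^ 2 := by exact_mod_cast hsq
  nlinarith

/-- Pell-type equation characterizing Chebyshev polynomials up to sign. -/
lemma eq_chebyshev_of_pell {b : ℂ[X]} {n : ℕ} (hn : b.natDegree = n) (hn1 : 1 ≤ n)
    (h : (X ^ 2 - 1) * derivative b ^ 2 = Polynomial.C ((n : ℂ) ^ 2) * (b ^ 2 - 1))
    (h1 : b.eval 1 ^ 2 = 1) : b = Chebyshev.T ℂ n ∨ b = -Chebyshev.T ℂ n := by
  have hb' : derivative b ≠ 0 := by
    rw [Ne, derivative_eq_zero]; omega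
  have hode : (X ^ 2 - 1) * derivative (derivative b) + X * derivative b =
      Polynomial.C ((n : ℂ) ^ 2) * b := by
    have hd := congrArg derivative h
    simp only [derivative_mul, derivative_sub, derivative_pow, derivative_X, derivative_one,
      derivative_C] at hd
    have h2 : (Polynomial.C 2 * derivative b : ℂ[X]) ≠ 0 := mul_ne_zero (by simp) hb'
    apply mul_left_cancel₀ h2
    simp only [map_ofNat, Nat.cast_ofNat] at hd ⊢
    linear_combination hd
  have hTdeg : (Chebyshev.T ℂ n).natDegree = n := by simp [Chebyshev.natDegree_T]
  set T := Chebyshev.T ℂ n with hT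
  have hTode : (X ^ 2 - 1) * derivative (derivative T) + X * derivative T =
      Polynomial.C ((n : ℂ) ^ 2) * T := by
    have := Chebyshev.one_sub_X_sq_mul_derivative_derivative_T_eq_poly_in_T (R := ℂ) n
    simp only [Function.iterate_succ, Function.iterate_zero, Function.comp_apply, id] at this
    rw [← hT] at this
    push_cast at this
    simp only [map_pow, map_natCast]
    linear_combination -this
  have hT0 : T ≠ 0 := by
    intro h0
    rw [h0, natDegree_zero] at hTdeg
    omega
  set c := b.leadingCoeff / T.leadingCoeff with hc
  have hbT : b = Polynomial.C c * T := by
    rw [← sub_eq_zero]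
    refine eq_zero_of_chebyshev_ode (n := n) ?_ ?_
    · by_cases hz : b - Polynomial.C c * T = 0
      · rw [hz, natDegree_zero]; omega
      · refine lt_of_le_of_ne ?_ fun heq => hz ?_
        · refine (natDegree_sub_le _ _).trans (max_le hn.le ?_)
          exact (natDegree_C_mul_le _ _).trans hTdeg.le
        · rw [← leadingCoeff_eq_zero, leadingCoeff, heq, coeff_sub, coeff_C_mul]
          nth_rewrite 1 [← hn]
          rw [← hTdeg, coeff_natDegree, coeff_natDegree, hc,
            div_mul_cancel₀ _ (leadingCoeff_ne_zero.2 hT0), sub_self]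
    · simp only [derivative_sub, derivative_C_mul]
      linear_combination hode - Polynomial.C c * hTode
  rw [hbT, eval_mul, eval_C, hT, Chebyshev.T_eval_one, mul_one, sq_eq_one_iff] at h1
  rcases h1 with h1 | h1
  · left; rw [hbT, h1]; simp
  · right; rw [hbT, h1]; simp

/-- A polynomial which takes the values `±1` with multiplicity one at `±1` and with multiplicity two
at all other points is a Chebyshev polynomial up to sign. -/
lemma eq_chebyshev_of_rootMultiplicity {b : ℂ[X]} {n : ℕ} (hn : b.natDegree = n) (hn1 : 1 ≤ n)
    (h1 : b.eval 1 ^ 2 = 1)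
    (hone : ∀ z : ℂ, z ^ 2 = 1 → (b - Polynomial.C (b.eval z)).rootMultiplicity z = 1)
    (htwo : ∀ z : ℂ, b.eval z ^ 2 = 1 → z ^ 2 ≠ 1 →
      (b - Polynomial.C (b.eval z)).rootMultiplicity z = 2) :
    b = Chebyshev.T ℂ n ∨ b = -Chebyshev.T ℂ n := by
  have hb' : derivative b ≠ 0 := by
    rw [Ne, derivative_eq_zero]; omega
  have hX2 : (X ^ 2 - 1 : ℂ[X]).natDegree = 2 := by
    rw [← Polynomial.C_1]; exact natDegree_X_pow_sub_C
  have hX0 : (X ^ 2 - 1 : ℂ[X]) ≠ 0 := by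
    intro h0; rw [h0] at hX2; simp at hX2
  have hR0 : (X ^ 2 - 1 : ℂ[X]) * derivative b ^ 2 ≠ 0 := mul_ne_zero hX0 (pow_ne_zero 2 hb')
  have hbn : (b ^ 2).natDegree = 2 * n := by rw [natDegree_pow, hn]
  have hLn : (b ^ 2 - 1).natDegree = 2 * n := by
    rw [← Polynomial.C_1, natDegree_sub_C, hbn]
  have hL0 : b ^ 2 - 1 ≠ 0 := by
    intro h0; rw [h0, natDegree_zero] at hLn; omega
  have hb'n : (derivative b).natDegree = n - 1 := by rw [natDegree_derivative, hn]
  have hRn : ((X ^ 2 - 1 : ℂ[X]) * derivative b ^ 2).natDegree = 2 * n := by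
    rw [natDegree_mul hX0 (pow_ne_zero 2 hb'), natDegree_pow, hX2, hb'n]
    omega
  have hdvd : b ^ 2 - 1 ∣ (X ^ 2 - 1) * derivative b ^ 2 := by
    classical
    rw [IsAlgClosed.dvd_iff_roots_le_roots hL0 hR0, Multiset.le_iff_count]
    intro z
    rw [count_roots, count_roots]
    by_cases hz : b.eval z ^ 2 = 1
    · have hfac : b ^ 2 - 1 =
          (b - Polynomial.C (b.eval z)) * (b + Polynomial.C (b.eval z)) := by
        have : Polynomial.C (b.eval z) ^ 2 = 1 := by rw [← Polynomial.C_pow, hz, Polynomial.C_1]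
        linear_combination this
      have hplus : (b + Polynomial.C (b.eval z)).rootMultiplicity z = 0 := by
        apply rootMultiplicity_eq_zero
        rw [IsRoot, eval_add, eval_C]
        intro h0
        have h0' : b.eval z = 0 := by linear_combination h0 / 2
        rw [h0'] at hz
        norm_num at hz
      have hL : (b ^ 2 - 1).rootMultiplicity z =
          (b - Polynomial.C (b.eval z)).rootMultiplicity z := by
        rw [hfac, rootMultiplicity_mul (hfac ▸ hL0), hplus, add_zero]
      have hder : (derivative b).rootMultiplicity z =
          (b - Polynomial.C (b.eval z)).rootMultiplicity z - 1 := by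
        rw [← derivative_rootMultiplicity_of_root (by simp), derivative_sub, derivative_C, sub_zero]
      have hsq : (derivative b ^ 2).rootMultiplicity z = 2 * (derivative b).rootMultiplicity z := by
        rw [pow_two, rootMultiplicity_mul (mul_ne_zero hb' hb')]; ring
      rw [rootMultiplicity_mul hR0, hsq, hL, hder]
      by_cases hz1 : z ^ 2 = 1
      · rw [hone z hz1]
        have : 0 < (X ^ 2 - 1 : ℂ[X]).rootMultiplicity z := by
          rw [rootMultiplicity_pos hX0]; simp [hz1]
        omega
      · rw [htwo z hz hz1]; omega
    · rw [rootMultiplicity_eq_zero]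
      · exact Nat.zero_le _
      · rw [IsRoot, eval_sub, eval_pow, eval_one, sub_eq_zero]; exact hz
  obtain ⟨q, hq⟩ := hdvd
  have hq0 : q ≠ 0 := by rintro rfl; rw [mul_zero] at hq; exact hR0 hq
  have hqn : q.natDegree = 0 := by
    have := congrArg natDegree hq
    rw [hRn, natDegree_mul hL0 hq0, hLn] at this
    omega
  obtain ⟨c, rfl⟩ := natDegree_eq_zero.1 hqn
  have hcn : c = (n : ℂ) ^ 2 := by
    have hlead := congrArg leadingCoeff hq
    have hXl : (X ^ 2 - 1 : ℂ[X]).leadingCoeff = 1 := by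
      rw [← Polynomial.C_1]; exact leadingCoeff_X_pow_sub_C (by norm_num)
    have hLl : (b ^ 2 - 1).leadingCoeff = b.leadingCoeff ^ 2 := by
      rw [leadingCoeff, hLn, coeff_sub, ← hbn, coeff_natDegree, leadingCoeff_pow, hbn,
        coeff_one, if_neg (by omega), sub_zero]
    have hDl : (derivative b).leadingCoeff = n * b.leadingCoeff := by
      rw [leadingCoeff, hb'n, coeff_derivative, Nat.sub_add_cancel hn1, ← hn, coeff_natDegree]
      have : ((b.natDegree - 1 : ℕ) : ℂ) + 1 = b.natDegree := by
        rw [hn]; exact_mod_cast congrArg (Nat.cast (R := ℂ)) (Nat.sub_add_cancel hn1)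
      rw [this, mul_comm]
    rw [leadingCoeff_mul, leadingCoeff_mul, leadingCoeff_pow, hXl, hLl, hDl, leadingCoeff_C]
      at hlead
    have hbl : b.leadingCoeff ^ 2 ≠ 0 := by
      refine pow_ne_zero 2 (leadingCoeff_ne_zero.2 ?_)
      rintro rfl
      exact hb' derivative_zero
    apply mul_left_cancel₀ hbl
    linear_combination -hlead
  refine eq_chebyshev_of_pell hn hn1 ?_ h1
  rw [hq, hcn, mul_comm]

/-- Every rational function is a rational function of a given Möbius transformation. -/
lemma exists_comp_eq_of_degree_eq_one {μ : RatFunc ℂ} (hμ : degree μ = 1) (F : RatFunc ℂ) :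
    ∃ B : RatFunc ℂ, comp B μ = F := by
  have htop : IntermediateField.adjoin ℂ {μ} = ⊤ := by
    rw [← IntermediateField.finrank_eq_one_iff_eq_top, RatFunc.finrank_eq_max_natDegree]
    exact hμ
  have hF : F ∈ IntermediateField.adjoin ℂ {μ} := htop ▸ IntermediateField.mem_top
  rw [IntermediateField.mem_adjoin_simple_iff] at hF
  obtain ⟨P, Q, rfl⟩ := hF
  refine ⟨algebraMap _ _ P / algebraMap _ _ Q, ?_⟩
  rw [← compHom_apply μ hμ.ge, map_div₀, compHom_apply, compHom_apply, comp_algebraMap_left,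
    comp_algebraMap_left]

/-- Möbius transformations can send three given points to `∞`, `1` and `-1`. -/
lemma exists_mobius {w a b : Sphere} (ha : a ≠ w) (hb : b ≠ w) (hab : a ≠ b) :
    ∃ μ : RatFunc ℂ, degree μ = 1 ∧ toMap μ w = OnePoint.infty ∧
      toMap μ a = (1 : ℂ) ∧ toMap μ b = (-1 : ℂ) := by
  classical
  obtain ⟨κ, hκ0, hκ⟩ := exists_ord_eq ha.symm
  have hκ1 : degree κ = 1 := by
    refine degree_eq_one_of_ord_eq (p := w) (q := a) (by simp [hκ]) (by simp [hκ, ha.symm]) ?_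
    intro z hzw hza
    simp [hκ, hzw, hza]
  have hκw : toMap κ w = OnePoint.infty := by
    rw [toMap_eq_infty_iff_ord hκ1.ge, hκ]; simp [ha.symm]
  have hκa : toMap κ a = (0 : ℂ) := by
    rw [toMap_eq_coe_iff_ord hκ1.ge, map_zero, sub_zero, hκ]; simp
  have hinj := (toMap_bijective_of_degree_eq_one hκ1).1
  obtain ⟨t, ht⟩ : ∃ t : ℂ, toMap κ b = t := by
    rcases h : toMap κ b with _ | t
    · exact absurd (hinj (h.trans hκw.symm)) hb
    · exact ⟨t, rfl⟩
  have ht0 : t ≠ 0 := by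
    rintro rfl
    exact hab (hinj (hκa.trans ht.symm))
  -- The affine map fixing `∞` and sending `0`, `t` to `1`, `-1`.
  set P : ℂ[X] := Polynomial.C (-2 / t) * X + Polynomial.C 1 with hP
  set σ : RatFunc ℂ := algebraMap _ _ P with hσ
  have hPn : P.natDegree = 1 := natDegree_linear (div_ne_zero (by norm_num) ht0)
  have hσ1 : degree σ = 1 := by
    rw [degree, hσ, RatFunc.num_algebraMap, RatFunc.denom_algebraMap, hPn]; simp
  have hσinf : toMap σ OnePoint.infty = OnePoint.infty := by
    rw [toMap_infty_eq_infty_iff, hσ1, hσ, RatFunc.denom_algebraMap, coeff_one]; simp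
  have hσz : ∀ z : ℂ, toMap σ (z : Sphere) = (P.eval z : ℂ) := by
    intro z
    rw [toMap_coe, hσ, RatFunc.num_algebraMap, RatFunc.denom_algebraMap]; simp
  have hmap := toMap_comp hσ1.ge hκ1.ge
  have hinf : ∀ z, toMap (comp σ κ) z = OnePoint.infty ↔ z = w := by
    intro z
    rw [hmap]
    constructor
    · intro h
      exact hinj (((toMap_bijective_of_degree_eq_one hσ1).1 (h.trans hσinf.symm)).trans hκw.symm)
    · rintro rfl
      rw [hκw, hσinf]
  refine ⟨comp σ κ, ?_, (hinf w).2 rfl, ?_, ?_⟩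
  · rw [← localDegree_eq_degree_of_fiber (degree_comp_pos hσ1.ge hκ1.ge) hinf,
      localDegree_comp hσ1.ge hκ1.ge, localDegree_of_degree_eq_one hσ1,
      localDegree_of_degree_eq_one hκ1]
  · rw [hmap, hκa, hσz]; simp [hP]
  · rw [hmap, ht, hσz]
    congr 1
    simp only [hP, eval_add, eval_mul, eval_C, eval_X]
    field_simp
    norm_num

lemma IsChebyshevLike.of_semiconj {A B μ : RatFunc ℂ} {w a b : Sphere}
    (h : IsChebyshevLike A w a b) (hμ : Function.Bijective (toMap μ))
    (hmap : ∀ z, toMap B (toMap μ z) = toMap μ (toMap A z))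
    (hdeg : ∀ z, localDegree B (toMap μ z) = localDegree A z) :
    IsChebyshevLike B (toMap μ w) (toMap μ a) (toMap μ b) where
  ne_left := hμ.1.ne h.ne_left
  ne_right := hμ.1.ne h.ne_right
  ne := hμ.1.ne h.ne
  toMap_eq_iff := by
    refine hμ.2.forall.2 fun z => ?_
    rw [hmap, hμ.1.eq_iff, hμ.1.eq_iff, h.toMap_eq_iff]
  toMap_left := by
    rw [hmap, hμ.1.eq_iff, hμ.1.eq_iff]; exact h.toMap_left
  toMap_right := by
    rw [hmap, hμ.1.eq_iff, hμ.1.eq_iff]; exact h.toMap_right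
  localDegree_left := by rw [hdeg, h.localDegree_left]
  localDegree_right := by rw [hdeg, h.localDegree_right]
  localDegree_eq_two := by
    refine hμ.2.forall.2 fun z => ?_
    rw [hmap, hμ.1.eq_iff, hμ.1.eq_iff, hdeg]
    exact fun hz hza hzb => h.localDegree_eq_two z hz (ne_of_apply_ne _ hza) (ne_of_apply_ne _ hzb)

/-- With its distinguished points at `∞`, `1` and `-1`, a rational function with the ramification of
a Chebyshev polynomial is a Chebyshev polynomial up to sign. -/
lemma eq_chebyshev_of_isChebyshevLike {B : RatFunc ℂ} (hB : 1 ≤ degree B)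
    (h : IsChebyshevLike B OnePoint.infty (1 : ℂ) (-1 : ℂ)) :
    ∃ d : ℕ, B = chebyshev d ∨ B = -chebyshev d := by
  have hden : B.denom = 1 := by
    refine eq_one_of_monic_natDegree_zero B.monic_denom ?_
    by_contra hne
    obtain ⟨z, hz⟩ := IsAlgClosed.exists_root B.denom (by
      rw [degree_eq_natDegree B.denom_ne_zero]; exact_mod_cast hne)
    have := (h.toMap_eq_iff z).1 ((toMap_coe_eq_infty_iff B z).2 hz)
    simp at this
  set b := B.num with hb
  have hBb : B = algebraMap _ _ b := by
    conv_lhs => rw [← B.num_div_denom, hden, map_one, div_one]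
  have hdeg : b.natDegree = degree B := by
    rw [degree, hden, natDegree_one, max_eq_left (Nat.zero_le _)]
  have hmap : ∀ z : ℂ, toMap B (z : Sphere) = (b.eval z : ℂ) := by
    intro z
    rw [toMap_coe, hden, ← hb]; simp
  have hloc : ∀ z : ℂ, localDegree B (z : Sphere) =
      (b - Polynomial.C (b.eval z)).rootMultiplicity z := by
    intro z
    rw [localDegree_eq_fiberMultiplicity B (hmap z), fiberMultiplicity_coe]
    change (B.num - Polynomial.C _ * B.denom).rootMultiplicity z = _
    rw [hden, mul_one]
  have h1 : b.eval 1 ^ 2 = 1 := by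
    rw [sq_eq_one_iff]
    have := h.toMap_left
    rwa [hmap, OnePoint.coe_eq_coe, OnePoint.coe_eq_coe] at this
  have hone : ∀ z : ℂ, z ^ 2 = 1 →
      (b - Polynomial.C (b.eval z)).rootMultiplicity z = 1 := by
    intro z hz
    rw [← hloc]
    rcases sq_eq_one_iff.1 hz with rfl | rfl
    · exact h.localDegree_left
    · exact h.localDegree_right
  have htwo : ∀ z : ℂ, b.eval z ^ 2 = 1 → z ^ 2 ≠ 1 →
      (b - Polynomial.C (b.eval z)).rootMultiplicity z = 2 := by
    intro z hbz hz
    rw [← hloc]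
    rw [Ne, sq_eq_one_iff, not_or] at hz
    rw [sq_eq_one_iff] at hbz
    refine h.localDegree_eq_two z ?_ ?_ ?_
    · rwa [hmap, OnePoint.coe_eq_coe, OnePoint.coe_eq_coe]
    · rw [Ne, OnePoint.coe_eq_coe]; exact hz.1
    · rw [Ne, OnePoint.coe_eq_coe]; exact hz.2
  refine ⟨degree B, ?_⟩
  rcases eq_chebyshev_of_rootMultiplicity hdeg hB h1 hone htwo with hT | hT
  · left; rw [chebyshev, ← hT]; exact hBb
  · right; rw [chebyshev, ← map_neg, ← hT]; exact hBb

lemma conjugate_chebyshev {A : RatFunc ℂ} (hA1 : 1 ≤ degree A) {w a b : Sphere}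
    (h : IsChebyshevLike A w a b) :
    ∃ d : ℕ, Conjugate A (chebyshev d) ∨ Conjugate A (-chebyshev d) := by
  obtain ⟨μ, hμ, hμw, hμa, hμb⟩ := exists_mobius h.ne_left h.ne_right h.ne
  obtain ⟨B, hB⟩ := exists_comp_eq_of_degree_eq_one hμ (comp μ A)
  have hB1 : 1 ≤ degree B := by
    refine degree_pos_of_ne_C fun c hc => ?_
    rw [hc, comp_C_left] at hB
    exact ne_C_of_degree_pos (degree_comp_pos hμ.ge hA1) c hB.symm
  have hlike := h.of_semiconj (B := B) (toMap_bijective_of_degree_eq_one hμ)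
    (fun z => by rw [← toMap_comp hB1 hμ.ge, hB, toMap_comp hμ.ge hA1])
    (fun z => by
      have h1 := localDegree_comp hB1 hμ.ge z
      rw [hB, localDegree_comp hμ.ge hA1, localDegree_of_degree_eq_one hμ,
        localDegree_of_degree_eq_one hμ] at h1
      omega)
  rw [hμw, hμa, hμb] at hlike
  obtain ⟨d, rfl | rfl⟩ := eq_chebyshev_of_isChebyshevLike hB1 hlike
  · exact ⟨d, Or.inl ⟨μ, hμ, hB.symm⟩⟩
  · exact ⟨d, Or.inr ⟨μ, hμ, hB.symm⟩⟩

/-! ### The maximal invariant orbifold -/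

/-- The trivial orbifold structure, without singular points. -/
def Orbifold.trivial : Orbifold where
  ν := fun _ => 1
  pos := fun _ => one_pos
  finite_singular := by simp
  not_one_point := fun z h => by simpa using (Set.ext_iff.1 h z).2 rfl
  two_points := fun _ _ _ => rfl

/-- The product of the ramification indices of an orbifold. -/
def Orbifold.weight (O : Orbifold) : ℕ := ∏ z ∈ O.support, O.ν z

lemma Orbifold.weight_eq_prod (O : Orbifold) {T : Finset Sphere} (hT : O.support ⊆ T) :
    O.weight = ∏ z ∈ T, O.ν z :=
  Finset.prod_subset hT fun z _ hz => by simpa using hz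

lemma Orbifold.Precedes.antisymm {O₁ O₂ : Orbifold} (h₁ : O₁.Precedes O₂)
    (h₂ : O₂.Precedes O₁) : O₁ = O₂ := by
  ext z
  exact Nat.dvd_antisymm (h₁ z) (h₂ z)

lemma Orbifold.Precedes.trans {O₁ O₂ O₃ : Orbifold} (h₁ : O₁.Precedes O₂)
    (h₂ : O₂.Precedes O₃) : O₁.Precedes O₃ := fun z => (h₁ z).trans (h₂ z)

lemma Orbifold.Precedes.eq_of_weight_le {O₁ O₂ : Orbifold} (h : O₁.Precedes O₂)
    (hw : O₂.weight ≤ O₁.weight) : O₁ = O₂ := by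
  have hsub : O₁.support ⊆ O₂.support := by
    intro z hz
    rw [O₁.mem_support] at hz
    rw [O₂.mem_support]
    intro h1
    exact hz (Nat.dvd_one.1 (h1 ▸ h z))
  rw [O₁.weight_eq_prod hsub, weight] at hw
  have hle : ∀ z ∈ O₂.support, O₁.ν z ≤ O₂.ν z := fun z _ => Nat.le_of_dvd (O₂.pos z) (h z)
  have heq : ∀ z ∈ O₂.support, O₁.ν z = O₂.ν z := by
    by_contra! hne
    obtain ⟨z, hz, hzne⟩ := hne
    exact hw.not_gt (Finset.prod_lt_prod (fun z _ => O₁.pos z) hle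
      ⟨z, hz, lt_of_le_of_ne (hle z hz) hzne⟩)
  ext z
  by_cases hz : z ∈ O₂.support
  · exact heq z hz
  · have h1 : O₁.ν z = 1 := by simpa using fun h => hz (hsub h)
    have h2 : O₂.ν z = 1 := by simpa using hz
    rw [h1, h2]

/-- If the ramification of the invariant orbifolds is bounded, there is a maximal one: an invariant
orbifold of greatest weight equals its least common multiple with any other one. -/
lemma exists_isMaximalOrbifold {A : RatFunc ℂ} (hA : 2 ≤ degree A) {N : ℕ} (hN : 1 ≤ N)
    (h : ∀ O : Orbifold, IsMinimalHolomorphicMap A O O → ∀ z, O.ν z ≤ N) :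
    ∃ O, IsMaximalOrbifold A O := by
  have hA1 : 1 ≤ degree A := by omega
  have hbound : ∀ O : Orbifold, IsMinimalHolomorphicMap A O O → O.weight ≤ N ^ 4 := by
    intro O hO
    refine (Finset.prod_le_pow_card _ _ N fun z _ => h O hO z).trans ?_
    exact Nat.pow_le_pow_right hN (card_support_le_four hA hA1 hO)
  have htriv : IsMinimalHolomorphicMap A Orbifold.trivial Orbifold.trivial := fun z => by
    simp [Orbifold.trivial]
  obtain ⟨W, ⟨O, hO, rfl⟩, hmax⟩ : ∃ W ∈ {W | ∃ O : Orbifold, IsMinimalHolomorphicMap A O O ∧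
      O.weight = W}, ∀ W' ∈ {W | ∃ O : Orbifold, IsMinimalHolomorphicMap A O O ∧
      O.weight = W}, W' ≤ W := by
    have hbdd : BddAbove {W | ∃ O : Orbifold, IsMinimalHolomorphicMap A O O ∧ O.weight = W} :=
      ⟨N ^ 4, by rintro _ ⟨O, hO, rfl⟩; exact hbound O hO⟩
    exact ⟨_, Nat.sSup_mem ⟨_, Orbifold.trivial, htriv, rfl⟩ hbdd, fun W' hW' => le_csSup hbdd hW'⟩
  refine ⟨O, hO, fun O' hO' z => ?_⟩
  have heq : O = O.lcm O' := by
    refine Orbifold.Precedes.eq_of_weight_le (fun z => Nat.dvd_lcm_left _ _) ?_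
    exact hmax _ ⟨_, isMinimalHolomorphicMap_lcm hA1 hO hO', rfl⟩
  rw [heq]
  exact Nat.dvd_lcm_right _ _

end

end RationalOrbifold

theorem theorem1p2 (A : RatFunc ℂ) (hdeg : 2 ≤ RationalOrbifold.degree A)
    (hpow : ∀ d : ℕ, ¬ RationalOrbifold.Conjugate A (RatFunc.X ^ d) ∧
      ¬ RationalOrbifold.Conjugate A (RatFunc.X ^ d)⁻¹)
    (hcheb : ∀ d : ℕ, ¬ RationalOrbifold.Conjugate A (RationalOrbifold.chebyshev d) ∧
      ¬ RationalOrbifold.Conjugate A (-RationalOrbifold.chebyshev d)) :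
    ∃ O₀ : RationalOrbifold.Orbifold,
      (RationalOrbifold.IsMinimalHolomorphicMap A O₀ O₀ ∧
        ∀ O : RationalOrbifold.Orbifold,
          RationalOrbifold.IsMinimalHolomorphicMap A O O → O.Precedes O₀) ∧
      ∀ l : ℕ, 1 ≤ l → ∀ O : RationalOrbifold.Orbifold,
        RationalOrbifold.IsMaximalOrbifold (RationalOrbifold.iterate A l) O ↔ O = O₀ := by
  open RationalOrbifold in
  have hA1 : 1 ≤ degree A := by omega
  have hbound : ∀ O : Orbifold, IsMinimalHolomorphicMap A O O → ∀ z, O.ν z ≤ degree A ^ 4 := by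
    intro O hO z
    by_contra! hz
    rcases exceptional_of_large_ramification hdeg hA1 hO hz with
      ⟨p, q, hpq, hp, hq⟩ | ⟨p, q, hpq, hp, hq⟩ | ⟨w, a, b, h⟩
    · exact (hpow _).1 (conjugate_pow hdeg hpq hp hq)
    · exact (hpow _).2 (conjugate_inv_pow hA1 hpq hp hq)
    · obtain ⟨d, hd | hd⟩ := conjugate_chebyshev hA1 h
      · exact (hcheb d).1 hd
      · exact (hcheb d).2 hd
  obtain ⟨O₀, hO₀, hmax⟩ := exists_isMaximalOrbifold hdeg (Nat.one_le_pow 4 _ hA1) hbound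
  have hmaxl : ∀ l : ℕ, 1 ≤ l → IsMaximalOrbifold (iterate A l) O₀ := by
    refine fun l hl => ⟨isMinimalHolomorphicMap_iterate hA1 hO₀ hl, fun O hO => ?_⟩
    obtain ⟨M, hM, hOM⟩ := exists_precedes_of_iterate hA1 hl hO
    exact hOM.trans (hmax M hM)
  refine ⟨O₀, ⟨hO₀, hmax⟩, fun l hl O => ⟨fun hO => ?_, ?_⟩⟩
  · exact ((hmaxl l hl).2 O hO.1).antisymm (hO.2 O₀ (hmaxl l hl).1)
  · rintro rfl
    exact hmaxl l hl
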